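/- There is an absolute constant $C>0$ such that the following holds. Let $x_{t+1}=A^*x_t+w_t$, $t=0,1,2,\dots$, be a linear system in $\mathbb{R}^d$ with random initial state $x_0$ and random disturbances $w_t$, all on one probability space, and let $\mathcal F_t=\sigma(x_0,w_0,\dots,w_{t-1})$. A time $t$ is called an attack time if $w_t\neq 0$. For a real random variable $Z$ let $\|Z\|_{\psi_2}=\inf\{c>0:\mathbb{E}[\exp(Z^2/c^2)]\le 2\}$, and for a random vector $X$ let $\|X\|_{\psi_2}=\sup_{\|y\|_2\le 1}\|X^Ty\|_{\psi_2}$. Assume: 1. $\|A^*\|_2<1$ (operator norm); 2. for some $\sigma_w>0$: $\|x_0\|_{\psi_2}\le\sigma_w$ and, for all $t\ge 0$, almost surely $\|w_t\|_{\psi_2}\le\sigma_w$ with respect to the conditional law of $w_t$ given $\mathcal F_t$ and given that $t$ is an attack time; 3. for some $0<p<1/2$: for all $t\ge 0$, $\mathbb{P}(w_t=0\mid\mathcal F_t)=1-p$ almost surely; 4. for some $\lambda>0$: for all $t\ge 0$, almost surely, for every $x\in\mathbb{R}^d$, $\mathbb{E}[(x+w_t)(x+w_t)^T]\succeq\lambda^2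 I_d$, the expectation being taken under the conditional law of $w_t$ given $\mathcal F_t$ and given that $t$ is an attack time. The disturbances are otherwise arbitrary (they may be chosen adversarially depending on $\mathcal F_t$ and have nonzero mean). Put $\tau=\sigma_w/\lambda$ and let $\delta\in(0,1]$. Then for every integer $$T\ \ge\ C\,\frac{d\,\max\{1,\tau^{10}\}}{p(1-2p)^2(1-\|A^*\|_2)^2}\,\max\Bigl\{1,\log\frac{d\,\tau}{\delta(1-2p)(1-\|A^*\|_2)}\Bigr\},$$ with probability at least $1-\delta$ the matrix $A^*$ is the unique minimizer over $A\in\mathbb{R}^{d\times d}$ of the $l_1$-norm objective $\sum_{t=0}^{T-1}\|x_{t+1}-Ax_t\|_1$. -/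

import Mathlib

open MeasureTheory ProbabilityTheory
open scoped ENNReal

/-- The sub-Gaussian norm `inf {c > 0 : E[exp (X² / c²)] ≤ 2}` of a real random variable `X` under
the law `ν`, as an extended nonnegative real; it is `∞` exactly when `X` is not sub-Gaussian. -/
noncomputable def psiTwoNorm {S : Type*} [MeasurableSpace S] (X : S → ℝ) (ν : Measure S) : ℝ≥0∞ :=
  ⨅ (c : ℝ) (_ : 0 < c) (_ : ∫⁻ s, ENNReal.ofReal (Real.exp (X s ^ 2 / c ^ 2)) ∂ν ≤ 2),
    ENNReal.ofReal c

/-- The sub-Gaussian norm of a random vector: the supremum over `‖y‖₂ ≤ 1` of the sub-Gaussian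
norms of the scalar variables `Xᵀ y`. -/
noncomputable def vecPsiTwoNorm {S : Type*} [MeasurableSpace S] {d : ℕ}
    (X : S → EuclideanSpace ℝ (Fin d)) (ν : Measure S) : ℝ≥0∞ :=
  ⨆ (y : EuclideanSpace ℝ (Fin d)) (_ : ‖y‖ ≤ 1), psiTwoNorm (fun s => inner ℝ (X s) y) ν

/-- The operator norm `‖A‖₂` of a square matrix, induced by the Euclidean norm. -/
noncomputable def opNormTwo {d : ℕ} (A : Matrix (Fin d) (Fin d) ℝ) : ℝ :=
  ‖Matrix.toEuclideanCLM (𝕜 := ℝ) A‖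

/-- The trajectory of `x_{t+1} = A x_t + w_t` started at `x_0`. -/
noncomputable def traj {d : ℕ} (A : Matrix (Fin d) (Fin d) ℝ) (x₀ : EuclideanSpace ℝ (Fin d))
    (w : ℕ → EuclideanSpace ℝ (Fin d)) : ℕ → EuclideanSpace ℝ (Fin d)
  | 0 => x₀
  | t + 1 => Matrix.toEuclideanCLM (𝕜 := ℝ) A (traj A x₀ w t) + w t

/-- The objective `∑_{t=0}^{T-1} ‖x_{t+1} - B x_t‖₁` of the `l₁`-norm estimator. -/
noncomputable def lOneLoss {d : ℕ} (x : ℕ → EuclideanSpace ℝ (Fin d)) (T : ℕ)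
    (B : Matrix (Fin d) (Fin d) ℝ) : ℝ :=
  ∑ t ∈ Finset.range T, ∑ i, |(x (t + 1) - Matrix.toEuclideanCLM (𝕜 := ℝ) B (x t)) i|

/-- The set of solutions of the `l₁`-norm estimator based on `x_0, …, x_T`. -/
def lOneSolutions {d : ℕ} (x : ℕ → EuclideanSpace ℝ (Fin d)) (T : ℕ) :
    Set (Matrix (Fin d) (Fin d) ℝ) :=
  {B | ∀ B' : Matrix (Fin d) (Fin d) ℝ, lOneLoss x T B ≤ lOneLoss x T B'}

/-- The history `(x_0, w_0, …, w_{t-1})`, which generates `ℱ_t`. -/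
def history {Ω : Type*} {d : ℕ} (x₀ : Ω → EuclideanSpace ℝ (Fin d))
    (w : ℕ → Ω → EuclideanSpace ℝ (Fin d)) (t : ℕ) (ω : Ω) :
    EuclideanSpace ℝ (Fin d) × (Fin t → EuclideanSpace ℝ (Fin d)) :=
  (x₀ ω, fun k => w k ω)

/-- The (regular) conditional law of `w_t` given `ℱ_t = σ(x_0, w_0, …, w_{t-1})`, at the history
realized at `ω`. -/
noncomputable def disturbanceLaw {Ω : Type*} [MeasurableSpace Ω] {d : ℕ} (μ : Measure Ω)
    [IsFiniteMeasure μ] (x₀ : Ω → EuclideanSpace ℝ (Fin d))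
    (w : ℕ → Ω → EuclideanSpace ℝ (Fin d)) (t : ℕ) (ω : Ω) :
    Measure (EuclideanSpace ℝ (Fin d)) :=
  condDistrib (w t) (history x₀ w t) μ (history x₀ w t ω)

/-- The conditional law of `w_t` given `ℱ_t` and given that `t` is an attack time (`w_t ≠ 0`). -/
noncomputable def attackLaw {Ω : Type*} [MeasurableSpace Ω] {d : ℕ} (μ : Measure Ω)
    [IsFiniteMeasure μ] (x₀ : Ω → EuclideanSpace ℝ (Fin d))
    (w : ℕ → Ω → EuclideanSpace ℝ (Fin d)) (t : ℕ) (ω : Ω) :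
    Measure (EuclideanSpace ℝ (Fin d)) :=
  ProbabilityTheory.cond (disturbanceLaw μ x₀ w t ω) {0}ᶜ

/-- The matrix `E[(x + v)(x + v)ᵀ]` for `v` distributed according to `ν`. -/
noncomputable def shiftedSecondMoment {d : ℕ} (ν : Measure (EuclideanSpace ℝ (Fin d)))
    (x : EuclideanSpace ℝ (Fin d)) : Matrix (Fin d) (Fin d) ℝ :=
  Matrix.of fun i j => ∫ v, (x + v) i * (x + v) j ∂ν

/-- Probabilistic attack: given `ℱ_t`, there is no attack (`w_t = 0`) with probability `1 - p`. -/
def HasAttackProbability {Ω : Type*} [MeasurableSpace Ω] {d : ℕ} (μ : Measure Ω)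
    [IsFiniteMeasure μ] (x₀ : Ω → EuclideanSpace ℝ (Fin d))
    (w : ℕ → Ω → EuclideanSpace ℝ (Fin d)) (p : ℝ) : Prop :=
  ∀ t, ∀ᵐ ω ∂μ, disturbanceLaw μ x₀ w t ω {0} = ENNReal.ofReal (1 - p)

/-- Maximum sub-Gaussian norm: `‖x_0‖_{ψ₂} ≤ σ`, and `‖w_t‖_{ψ₂} ≤ σ` given `ℱ_t` at every attack
time `t` (at the other times `w_t = 0`, and there is nothing to bound). -/
def HasSubGaussianBound {Ω : Type*} [MeasurableSpace Ω] {d : ℕ} (μ : Measure Ω)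
    [IsFiniteMeasure μ] (x₀ : Ω → EuclideanSpace ℝ (Fin d))
    (w : ℕ → Ω → EuclideanSpace ℝ (Fin d)) (σ : ℝ) : Prop :=
  vecPsiTwoNorm x₀ μ ≤ ENNReal.ofReal σ ∧
    ∀ t, ∀ᵐ ω ∂μ, vecPsiTwoNorm (fun v => v) (attackLaw μ x₀ w t ω) ≤ ENNReal.ofReal σ

/-- Non-degeneracy: at every attack time `t`, given `ℱ_t`,
`E[(x + w_t)(x + w_t)ᵀ] ⪰ lam² I` for every vector `x`. -/
def IsNondegenerate {Ω : Type*} [MeasurableSpace Ω] {d : ℕ} (μ : Measure Ω)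
    [IsFiniteMeasure μ] (x₀ : Ω → EuclideanSpace ℝ (Fin d))
    (w : ℕ → Ω → EuclideanSpace ℝ (Fin d)) (lam : ℝ) : Prop :=
  ∀ t, ∀ᵐ ω ∂μ, ∀ x : EuclideanSpace ℝ (Fin d),
    (shiftedSecondMoment (attackLaw μ x₀ w t ω) x
      - lam ^ 2 • (1 : Matrix (Fin d) (Fin d) ℝ)).PosSemidef

/-!
The objective splits over the rows of the candidate matrix. Perturbing a residual `w_t` along a
direction `z` by `⟪z, x_t⟫` costs exactly `|⟪z, x_t⟫|` when there is no attack and gains at most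
`|⟪z, x_t⟫|` otherwise, so `A` is the unique minimizer as soon as the signed sum
`f z = ∑ t, ε_t |⟪z, x_t⟫|`, with `ε_t = 1` without attack and `ε_t = -1` under attack, is positive
for every `z ≠ 0` (`lOneSolutions_eq_singleton`). Neither the signs nor the means of the attacks
matter: given the past, `ε_t` has mean `1 - 2 p > 0`.

For a fixed unit vector `z` put `S = ∑ |⟪z, x_t⟫|` and `Q = ∑ ⟪z, x_t⟫²`. Three exponential
supermartingales (`measure_le_of_exp_moment`) show that, up to probability `3 exp (-L)`,
* `f z ≥ (1 - 2 p) S - 4 η Q - L / η` for a prescribed `η`, by a Hoeffding bound for `ε_t`;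
* `Q ≤ s² (1 + p T + L) / (1 - r)²`, where `s` is a sub-Gaussian scale and `‖A‖ ≤ r < 1`: the
  energy `∑ r⁻ᵏ ⟪z, Aᵏ v⟫²` is a Lyapunov function, fed only by the attacks and sub-exponential at a
  dimension-free scale;
* `S` is at least of order `lam p T (lam / s)⁴`: each attack moves the projection away from `0` with
  conditional probability of order `(lam / s)⁴`, whatever the current state, by a Paley–Zygmund
  argument (`small_ball_of_second_moment`).

Choosing `η` to balance these terms gives `f z ≥ G` with `G` proportional to `(1 - 2 p) p T`
(`measure_signed_sum_lt_gap`) once `T` exceeds the stated threshold; the power `τ ^ 10` is the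
squared small-ball constant times `τ ^ 2`. A fourth supermartingale bounds the Lipschitz constant
`∑ ‖x_t‖` of `f` by a multiple of `p T`. In the ratio of the two bounds `p T` cancels, so a net of
directions with `exp (O (d l))` points suffices, `l` being the logarithmic factor of the statement,
and `L` of order `d l` absorbs the union bound (`measure_recovery_failure_le`).
-/


/-! ### Exponential supermartingales along the trajectory -/

/-- One step of a supermartingale argument: if the conditional expectation of `φ (Z, Y)` given `X`
is at most `c` and `G`, `Z` are functions of `X`, then `E[G * φ (Z, Y)] ≤ c * E[G]`. -/
lemma lintegral_mul_le_of_condDistrib {Ω β S V : Type*} [MeasurableSpace Ω] [MeasurableSpace β]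
    [MeasurableSpace S] [StandardBorelSpace S] [Nonempty S]
    [MeasurableSpace V] [StandardBorelSpace V] [Nonempty V]
    {μ : Measure Ω} [IsFiniteMeasure μ] {X : Ω → β} {Y : Ω → V} (hX : Measurable X)
    (hY : Measurable Y) {G : Ω → ℝ≥0∞} (hG : Measurable[MeasurableSpace.comap X inferInstance] G)
    {Z : Ω → S} (hZ : Measurable[MeasurableSpace.comap X inferInstance] Z)
    {φ : S × V → ℝ≥0∞} (hφ : Measurable φ) {c : ℝ≥0∞}
    (h : ∀ᵐ ω ∂μ, ∫⁻ v, φ (Z ω, v) ∂(condDistrib Y X μ (X ω)) ≤ c) :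
    ∫⁻ ω, G ω * φ (Z ω, Y ω) ∂μ ≤ c * ∫⁻ ω, G ω ∂μ := by
  obtain ⟨G', hG', rfl⟩ := hG.exists_eq_measurable_comp
  obtain ⟨Z', hZ', rfl⟩ := hZ.exists_eq_measurable_comp
  have hm : Measurable fun q : β × V => G' q.1 * φ (Z' q.1, q.2) := by fun_prop
  calc ∫⁻ ω, (G' ∘ X) ω * φ ((Z' ∘ X) ω, Y ω) ∂μ
      = ∫⁻ q, G' q.1 * φ (Z' q.1, q.2) ∂(μ.map fun ω => (X ω, Y ω)) := by
        rw [lintegral_map hm (hX.prodMk hY)]; rfl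
    _ = ∫⁻ ω, ∫⁻ v, G' (X ω) * φ (Z' (X ω), v) ∂(condDistrib Y X μ (X ω)) ∂μ := by
        rw [← compProd_map_condDistrib hY.aemeasurable, Measure.lintegral_compProd hm,
          lintegral_map _ hX]
        exact Measurable.lintegral_kernel_prod_right' hm
    _ ≤ ∫⁻ ω, c * (G' ∘ X) ω ∂μ := by
        refine lintegral_mono_ae ?_
        filter_upwards [h] with ω hω
        rw [lintegral_const_mul _ (by fun_prop), mul_comm]
        exact mul_le_mul_left hω _
    _ = c * ∫⁻ ω, (G' ∘ X) ω ∂μ := lintegral_const_mul _ (by fun_prop)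

section Trajectory

variable {Ω : Type*} {d : ℕ}

lemma measurable_history [MeasurableSpace Ω] {x₀ : Ω → EuclideanSpace ℝ (Fin d)}
    {w : ℕ → Ω → EuclideanSpace ℝ (Fin d)} (hx₀ : Measurable x₀) (hw : ∀ t, Measurable (w t))
    (t : ℕ) : Measurable (history x₀ w t) := by
  unfold history
  exact hx₀.prodMk (measurable_pi_lambda _ fun k => hw k)

lemma measurable_initial_comap_history (x₀ : Ω → EuclideanSpace ℝ (Fin d))
    (w : ℕ → Ω → EuclideanSpace ℝ (Fin d)) (t : ℕ) :
    Measurable[MeasurableSpace.comap (history x₀ w t) inferInstance] x₀ :=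
  measurable_fst.comp (comap_measurable (history x₀ w t))

lemma measurable_disturbance_comap_history (x₀ : Ω → EuclideanSpace ℝ (Fin d))
    (w : ℕ → Ω → EuclideanSpace ℝ (Fin d)) {s t : ℕ} (hst : s < t) :
    Measurable[MeasurableSpace.comap (history x₀ w t) inferInstance] (w s) :=
  (measurable_pi_apply (⟨s, hst⟩ : Fin t)).comp
    (measurable_snd.comp (comap_measurable (history x₀ w t)))

lemma measurable_traj_comap_history (A : Matrix (Fin d) (Fin d) ℝ)
    (x₀ : Ω → EuclideanSpace ℝ (Fin d)) (w : ℕ → Ω → EuclideanSpace ℝ (Fin d)) {s t : ℕ}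
    (hst : s ≤ t) :
    Measurable[MeasurableSpace.comap (history x₀ w t) inferInstance]
      fun ω => traj A (x₀ ω) (fun k => w k ω) s := by
  induction s with
  | zero => exact measurable_initial_comap_history x₀ w t
  | succ s ih =>
    exact ((Matrix.toEuclideanCLM (𝕜 := ℝ) A).continuous.measurable.comp (ih (by omega))).add
      (measurable_disturbance_comap_history x₀ w (by omega))

variable [MeasurableSpace Ω] (μ : Measure Ω) [IsProbabilityMeasure μ] (A : Matrix (Fin d) (Fin d) ℝ)
  {x₀ : Ω → EuclideanSpace ℝ (Fin d)} {w : ℕ → Ω → EuclideanSpace ℝ (Fin d)}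

lemma lintegral_prod_traj_le (hx₀ : Measurable x₀) (hw : ∀ t, Measurable (w t))
    {φ : EuclideanSpace ℝ (Fin d) × EuclideanSpace ℝ (Fin d) → ℝ≥0∞} (hφ : Measurable φ)
    {c : ℝ≥0∞}
    (h : ∀ t, ∀ᵐ ω ∂μ,
      ∫⁻ v, φ (traj A (x₀ ω) (fun k => w k ω) t, v) ∂(disturbanceLaw μ x₀ w t ω) ≤ c)
    {φ₀ : EuclideanSpace ℝ (Fin d) → ℝ≥0∞} (hφ₀ : Measurable φ₀) (n : ℕ) :
    ∫⁻ ω, φ₀ (x₀ ω) *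
        ∏ t ∈ Finset.range n, φ (traj A (x₀ ω) (fun k => w k ω) t, w t ω) ∂μ
      ≤ c ^ n * ∫⁻ ω, φ₀ (x₀ ω) ∂μ := by
  induction n with
  | zero => simp
  | succ n ih =>
    have hG : Measurable[MeasurableSpace.comap (history x₀ w n) inferInstance] fun ω =>
        φ₀ (x₀ ω) * ∏ t ∈ Finset.range n, φ (traj A (x₀ ω) (fun k => w k ω) t, w t ω) := by
      refine (hφ₀.comp (measurable_initial_comap_history x₀ w n)).mul
        (Finset.measurable_fun_prod _ fun t ht => ?_)
      rw [Finset.mem_range] at ht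
      exact hφ.comp ((measurable_traj_comap_history A x₀ w ht.le).prodMk
        (measurable_disturbance_comap_history x₀ w ht))
    have key := lintegral_mul_le_of_condDistrib (measurable_history hx₀ hw n) (hw n) hG
      (measurable_traj_comap_history A x₀ w le_rfl) hφ (h n)
    simp only [Finset.prod_range_succ, ← mul_assoc]
    refine key.trans ?_
    rw [pow_succ', mul_assoc]
    exact mul_le_mul_right ih _

/-- Chernoff bound for additive functionals of the trajectory whose increments have conditional
exponential moments at most `exp c`. -/
lemma measure_le_of_exp_moment (hx₀ : Measurable x₀) (hw : ∀ t, Measurable (w t))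
    {g : EuclideanSpace ℝ (Fin d) × EuclideanSpace ℝ (Fin d) → ℝ} (hg : Measurable g) {c : ℝ}
    (h : ∀ t, ∀ᵐ ω ∂μ, ∫⁻ v, ENNReal.ofReal (Real.exp
      (g (traj A (x₀ ω) (fun k => w k ω) t, v))) ∂(disturbanceLaw μ x₀ w t ω)
        ≤ ENNReal.ofReal (Real.exp c))
    {g₀ : EuclideanSpace ℝ (Fin d) → ℝ} (hg₀ : Measurable g₀) {c₀ : ℝ}
    (h₀ : ∫⁻ ω, ENNReal.ofReal (Real.exp (g₀ (x₀ ω))) ∂μ ≤ ENNReal.ofReal (Real.exp c₀))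
    (n : ℕ) (L : ℝ) :
    μ {ω | c₀ + n * c + L ≤ g₀ (x₀ ω) +
        ∑ t ∈ Finset.range n, g (traj A (x₀ ω) (fun k => w k ω) t, w t ω)}
      ≤ ENNReal.ofReal (Real.exp (-L)) := by
  have key := lintegral_prod_traj_le μ A hx₀ hw
    (φ := fun q => ENNReal.ofReal (Real.exp (g q))) (by fun_prop) h
    (φ₀ := fun x => ENNReal.ofReal (Real.exp (g₀ x))) (by fun_prop) n
  have hprod : ∀ ω, ENNReal.ofReal (Real.exp (g₀ (x₀ ω))) * ∏ t ∈ Finset.range n,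
      ENNReal.ofReal (Real.exp (g (traj A (x₀ ω) (fun k => w k ω) t, w t ω)))
      = ENNReal.ofReal (Real.exp (g₀ (x₀ ω) +
        ∑ t ∈ Finset.range n, g (traj A (x₀ ω) (fun k => w k ω) t, w t ω))) := by
    intro ω
    rw [← ENNReal.ofReal_prod_of_nonneg fun _ _ => (Real.exp_pos _).le, ← Real.exp_sum,
      ← ENNReal.ofReal_mul (Real.exp_pos _).le, ← Real.exp_add]
  simp only [hprod] at key
  have htr : ∀ t, Measurable fun ω => traj A (x₀ ω) (fun k => w k ω) t := fun t =>
    (measurable_traj_comap_history A x₀ w le_rfl).mono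
      (measurable_history hx₀ hw t).comap_le le_rfl
  have hmeas : Measurable fun ω => ENNReal.ofReal (Real.exp (g₀ (x₀ ω) +
      ∑ t ∈ Finset.range n, g (traj A (x₀ ω) (fun k => w k ω) t, w t ω))) := by
    refine (Real.measurable_exp.comp ((hg₀.comp hx₀).add
      (Finset.measurable_fun_sum _ fun t _ => hg.comp ((htr t).prodMk (hw t))))).ennreal_ofReal
  have hmarkov := mul_meas_ge_le_lintegral (μ := μ) hmeas
    (ENNReal.ofReal (Real.exp (c₀ + n * c + L)))
  simp only [ENNReal.ofReal_le_ofReal_iff (Real.exp_pos _).le, Real.exp_le_exp] at hmarkov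
  have hbound : ENNReal.ofReal (Real.exp (c₀ + n * c + L)) *
      μ {ω | c₀ + n * c + L ≤ g₀ (x₀ ω) +
        ∑ t ∈ Finset.range n, g (traj A (x₀ ω) (fun k => w k ω) t, w t ω)}
      ≤ ENNReal.ofReal (Real.exp (c₀ + n * c)) := by
    refine hmarkov.trans (key.trans ((mul_le_mul_right h₀ _).trans (le_of_eq ?_)))
    rw [← ENNReal.ofReal_pow (Real.exp_pos _).le, ← Real.exp_nat_mul,
      ← ENNReal.ofReal_mul (Real.exp_pos _).le, ← Real.exp_add, add_comm]
  calc _ = ENNReal.ofReal (Real.exp (-(c₀ + n * c + L))) *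
        (ENNReal.ofReal (Real.exp (c₀ + n * c + L)) * μ {ω | c₀ + n * c + L ≤ g₀ (x₀ ω) +
        ∑ t ∈ Finset.range n, g (traj A (x₀ ω) (fun k => w k ω) t, w t ω)}) := by
        rw [← mul_assoc, ← ENNReal.ofReal_mul (Real.exp_pos _).le, ← Real.exp_add,
          neg_add_cancel, Real.exp_zero, ENNReal.ofReal_one, one_mul]
    _ ≤ ENNReal.ofReal (Real.exp (-(c₀ + n * c + L))) *
        ENNReal.ofReal (Real.exp (c₀ + n * c)) := mul_le_mul_right hbound _
    _ = ENNReal.ofReal (Real.exp (-L)) := by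
        rw [← ENNReal.ofReal_mul (Real.exp_pos _).le, ← Real.exp_add]
        congr 2; ring

end Trajectory

/-! ### Sub-Gaussian vectors and the law of an attack -/

/-- Quantitative sub-Gaussianity at scale `s`: every projection `⟪X, y⟫` on a vector of norm at
most one satisfies `E[exp (⟪X, y⟫² / s²)] ≤ 2`. -/
def IsSubGaussianVec {S : Type*} [MeasurableSpace S] {d : ℕ}
    (X : S → EuclideanSpace ℝ (Fin d)) (ν : Measure S) (s : ℝ) : Prop :=
  ∀ y : EuclideanSpace ℝ (Fin d), ‖y‖ ≤ 1 →
    ∫⁻ a, ENNReal.ofReal (Real.exp ((inner ℝ (X a) y) ^ 2 / s ^ 2)) ∂ν ≤ 2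

/-- The infimum defining the sub-Gaussian norm need not be attained a priori; doubling the scale
gives the moment bound without a limiting argument. -/
lemma isSubGaussianVec_of_vecPsiTwoNorm_le {S : Type*} [MeasurableSpace S] {d : ℕ}
    {X : S → EuclideanSpace ℝ (Fin d)} {ν : Measure S} {σ : ℝ} (hσ : 0 < σ)
    (h : vecPsiTwoNorm X ν ≤ ENNReal.ofReal σ) : IsSubGaussianVec X ν (2 * σ) := by
  intro y hy
  have h1 : psiTwoNorm (fun s => inner ℝ (X s) y) ν < ENNReal.ofReal (2 * σ) := by
    refine lt_of_le_of_lt ((le_iSup₂ (f := fun (y : EuclideanSpace ℝ (Fin d)) (_ : ‖y‖ ≤ 1) =>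
      psiTwoNorm (fun s => inner ℝ (X s) y) ν) y hy).trans h) ?_
    exact (ENNReal.ofReal_lt_ofReal_iff (by linarith)).2 (by linarith)
  simp only [psiTwoNorm, iInf_lt_iff] at h1
  obtain ⟨c, hc, hint, hlt⟩ := h1
  refine le_trans (lintegral_mono fun a => ENNReal.ofReal_le_ofReal (Real.exp_le_exp.2 ?_)) hint
  have hcs : c ≤ 2 * σ := ((ENNReal.ofReal_lt_ofReal_iff (by linarith)).1 hlt).le
  gcongr

/-- Sub-Gaussian moment bounds pass to weighted sums of squared projections of total weight at
most one, by convexity of the exponential. -/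
lemma IsSubGaussianVec.lintegral_exp_sum_le {S ι : Type*} [MeasurableSpace S] {d : ℕ}
    {X : S → EuclideanSpace ℝ (Fin d)} (hX : Measurable X) {ν : Measure S}
    [IsProbabilityMeasure ν] {s : ℝ} (h : IsSubGaussianVec X ν s) (I : Finset ι) {a : ι → ℝ}
    (ha : ∀ i ∈ I, 0 ≤ a i) (hsum : ∑ i ∈ I, a i ≤ 1) {y : ι → EuclideanSpace ℝ (Fin d)}
    (hy : ∀ i ∈ I, ‖y i‖ ≤ 1) :
    ∫⁻ b, ENNReal.ofReal (Real.exp (∑ i ∈ I, a i * ((inner ℝ (X b) (y i)) ^ 2 / s ^ 2))) ∂ν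
      ≤ 2 := by
  have hconv : ∀ b, Real.exp (∑ i ∈ I, a i * ((inner ℝ (X b) (y i)) ^ 2 / s ^ 2)) ≤
      (1 - ∑ i ∈ I, a i) + ∑ i ∈ I, a i * Real.exp ((inner ℝ (X b) (y i)) ^ 2 / s ^ 2) := by
    intro b
    -- the missing weight `1 - ∑ a i` is put on the point `0`
    have := convexOn_exp.map_add_sum_le (t := I) (w := a) (v := 1 - ∑ i ∈ I, a i) (q := 0)
      (p := fun i => (inner ℝ (X b) (y i)) ^ 2 / s ^ 2) ha (by ring)
      (fun i _ => Set.mem_univ _) (by linarith) (Set.mem_univ _)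
    simpa using this
  have hm : ∀ i, Measurable fun b =>
      ENNReal.ofReal (a i) * ENNReal.ofReal (Real.exp ((inner ℝ (X b) (y i)) ^ 2 / s ^ 2)) := by
    intro i; fun_prop
  calc _ ≤ ∫⁻ b, (ENNReal.ofReal (1 - ∑ i ∈ I, a i) + ∑ i ∈ I, ENNReal.ofReal (a i) *
          ENNReal.ofReal (Real.exp ((inner ℝ (X b) (y i)) ^ 2 / s ^ 2))) ∂ν := by
        refine lintegral_mono fun b => (ENNReal.ofReal_le_ofReal (hconv b)).trans ?_
        refine ENNReal.ofReal_add_le.trans (add_le_add le_rfl (le_of_eq ?_))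
        rw [ENNReal.ofReal_sum_of_nonneg fun i hi => mul_nonneg (ha i hi) (Real.exp_pos _).le]
        exact Finset.sum_congr rfl fun i hi => ENNReal.ofReal_mul (ha i hi)
    _ = ENNReal.ofReal (1 - ∑ i ∈ I, a i) + ∑ i ∈ I, ENNReal.ofReal (a i) *
          ∫⁻ b, ENNReal.ofReal (Real.exp ((inner ℝ (X b) (y i)) ^ 2 / s ^ 2)) ∂ν := by
        rw [lintegral_add_left measurable_const, lintegral_finsetSum _ fun i _ => hm i]
        simp only [lintegral_const, measure_univ, mul_one]
        congr 1
        exact Finset.sum_congr rfl fun i _ => lintegral_const_mul _ (by fun_prop)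
    _ ≤ ENNReal.ofReal (1 - ∑ i ∈ I, a i) * 2 + (∑ i ∈ I, ENNReal.ofReal (a i)) * 2 := by
        rw [Finset.sum_mul]
        refine add_le_add (le_mul_of_one_le_right' one_le_two)
          (Finset.sum_le_sum fun i hi => mul_le_mul_right (h _ (hy i hi)) _)
    _ = 2 := by
        rw [← add_mul, ← ENNReal.ofReal_sum_of_nonneg ha, ← ENNReal.ofReal_add (by linarith)
          (Finset.sum_nonneg ha)]
        simp

lemma IsSubGaussianVec.lintegral_exp_norm_sq_le {S : Type*} [MeasurableSpace S] {d : ℕ}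
    {X : S → EuclideanSpace ℝ (Fin d)} (hX : Measurable X) {ν : Measure S}
    [IsProbabilityMeasure ν] {s : ℝ} (h : IsSubGaussianVec X ν s) :
    ∫⁻ b, ENNReal.ofReal (Real.exp (‖X b‖ ^ 2 / (d * s ^ 2))) ∂ν ≤ 2 := by
  have h1 := h.lintegral_exp_sum_le hX Finset.univ (a := fun _ : Fin d => (d : ℝ)⁻¹)
    (fun _ _ => by positivity)
    (by
      rw [Finset.sum_const, Finset.card_univ, Fintype.card_fin, nsmul_eq_mul]
      exact mul_inv_le_one) (y := fun i => EuclideanSpace.single i 1)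
    (fun i _ => by simp)
  refine le_of_eq_of_le (lintegral_congr fun b => ?_) h1
  rw [EuclideanSpace.norm_sq_eq, Finset.sum_div]
  congr 3
  funext i
  simp [EuclideanSpace.inner_single_right]
  rw [div_eq_mul_inv, mul_inv]; ring

section Law

variable {d : ℕ} {ν : Measure (EuclideanSpace ℝ (Fin d))} [IsProbabilityMeasure ν] {p : ℝ}

lemma measure_compl_zero_of_attackProbability (hp1 : p ≤ 1)
    (h0 : ν {0} = ENNReal.ofReal (1 - p)) : ν {0}ᶜ = ENNReal.ofReal p := by
  rw [prob_compl_eq_one_sub (measurableSet_singleton 0), h0, ← ENNReal.ofReal_one,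
    ← ENNReal.ofReal_sub _ (by linarith)]
  congr 1; ring

/-- The law of a disturbance is the mixture of the Dirac mass at `0` and of the attack law. -/
lemma lintegral_eq_of_attackProbability (hp : 0 < p) (hp1 : p ≤ 1)
    (h0 : ν {0} = ENNReal.ofReal (1 - p)) (g : EuclideanSpace ℝ (Fin d) → ℝ≥0∞) :
    ∫⁻ v, g v ∂ν = ENNReal.ofReal (1 - p) * g 0
      + ENNReal.ofReal p * ∫⁻ v, g v ∂(ProbabilityTheory.cond ν {0}ᶜ) := by
  rw [← lintegral_add_compl g (measurableSet_singleton (0 : EuclideanSpace ℝ (Fin d))),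
    lintegral_singleton, h0, mul_comm, ProbabilityTheory.cond, lintegral_smul_measure,
    measure_compl_zero_of_attackProbability hp1 h0, smul_eq_mul, ← mul_assoc,
    ENNReal.mul_inv_cancel (by simpa using hp) ENNReal.ofReal_ne_top, one_mul]

lemma isProbabilityMeasure_cond_of_attackProbability (hp : 0 < p) (hp1 : p ≤ 1)
    (h0 : ν {0} = ENNReal.ofReal (1 - p)) :
    IsProbabilityMeasure (ProbabilityTheory.cond ν {0}ᶜ) := by
  refine cond_isProbabilityMeasure ?_
  rw [measure_compl_zero_of_attackProbability hp1 h0]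
  simpa using hp

/-- A functional vanishing in the absence of an attack, and with exponential moment at most `K`
under an attack, has exponential moment at most `exp ((K - 1) p)`. -/
lemma lintegral_exp_le_of_attackProbability (hp : 0 < p) (hp1 : p ≤ 1)
    (h0 : ν {0} = ENNReal.ofReal (1 - p)) {g : EuclideanSpace ℝ (Fin d) → ℝ} {K a : ℝ}
    (hg0 : g 0 ≤ a) (hK : 0 ≤ K) (hg : ∫⁻ v, ENNReal.ofReal (Real.exp (g v))
      ∂(ProbabilityTheory.cond ν {0}ᶜ) ≤ ENNReal.ofReal K) :
    ∫⁻ v, ENNReal.ofReal (Real.exp (g v)) ∂ν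
      ≤ ENNReal.ofReal ((1 - p) * Real.exp a + p * K) := by
  rw [lintegral_eq_of_attackProbability hp hp1 h0, ENNReal.ofReal_add
    (mul_nonneg (by linarith) (Real.exp_pos _).le) (by positivity),
    ENNReal.ofReal_mul (by linarith), ENNReal.ofReal_mul hp.le]
  gcongr

end Law

/-! ### Symmetric signs and small balls -/

lemma exp_le_add_exp_sq (x : ℝ) : Real.exp x ≤ x + Real.exp (x ^ 2) := by
  rcases le_or_gt |x| 1 with hx | hx
  · have h1 := (abs_le.1 (Real.abs_exp_sub_one_sub_id_le hx)).2
    have h2 := Real.add_one_le_exp (x ^ 2)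
    linarith
  · rcases lt_abs.1 hx with h | h
    · have : Real.exp x ≤ Real.exp (x ^ 2) := Real.exp_le_exp.2 (by nlinarith)
      linarith
    · have h1 : Real.exp x ≤ 1 := Real.exp_le_one_iff.2 (by linarith)
      have h2 := Real.add_one_le_exp (x ^ 2)
      nlinarith

/-- Hoeffding-type bound for a sign that equals `1` with probability `1 - p`. -/
lemma sign_exp_moment_le {p : ℝ} (hp : 0 ≤ p) (hp1 : p ≤ 1) (u : ℝ) :
    (1 - p) * Real.exp ((1 - 2 * p) * u - u - 4 * u ^ 2)
      + p * Real.exp ((1 - 2 * p) * u + u - 4 * u ^ 2) ≤ 1 := by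
  have h1 := exp_le_add_exp_sq (-(2 * p * u))
  have h2 := exp_le_add_exp_sq (2 * (1 - p) * u)
  have hp2 : p ^ 2 ≤ 1 := pow_le_one₀ hp hp1
  have hq2 : (1 - p) ^ 2 ≤ 1 := pow_le_one₀ (by linarith) (by linarith)
  have h3 : Real.exp ((-(2 * p * u)) ^ 2) ≤ Real.exp (4 * u ^ 2) :=
    Real.exp_le_exp.2 (by nlinarith [mul_le_mul_of_nonneg_right hp2 (sq_nonneg u)])
  have h4 : Real.exp ((2 * (1 - p) * u) ^ 2) ≤ Real.exp (4 * u ^ 2) :=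
    Real.exp_le_exp.2 (by nlinarith [mul_le_mul_of_nonneg_right hq2 (sq_nonneg u)])
  have e1 : (1 - 2 * p) * u - u - 4 * u ^ 2 = -(2 * p * u) + -(4 * u ^ 2) := by ring
  have e2 : (1 - 2 * p) * u + u - 4 * u ^ 2 = 2 * (1 - p) * u + -(4 * u ^ 2) := by ring
  rw [e1, e2, Real.exp_add, Real.exp_add, ← mul_assoc, ← mul_assoc, ← add_mul, Real.exp_neg (4 * u ^ 2),
    ← div_eq_mul_inv, div_le_one (Real.exp_pos _)]
  nlinarith

/-- Small-ball estimate (a Paley–Zygmund argument): a sub-Gaussian variable all of whose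
translates have second moment at least `lam ^ 2` stays away from every point with probability of
order `(lam / s) ^ 4`. -/
lemma small_ball_of_second_moment {S : Type*} [MeasurableSpace S] {κ : Measure S}
    [IsProbabilityMeasure κ] {Z : S → ℝ} (hZ : Measurable Z) {s lam : ℝ} (hs : 0 < s)
    (hlam : 0 < lam) (hsub : ∫⁻ b, ENNReal.ofReal (Real.exp (Z b ^ 2 / s ^ 2)) ∂κ ≤ 2)
    (hnd : ∀ a : ℝ, lam ^ 2 ≤ ∫ b, (a + Z b) ^ 2 ∂κ) :
    lam ≤ s ∧ ∀ a : ℝ, (lam / s) ^ 4 / 288 ≤ κ.real {b | lam / 2 ≤ |a + Z b|} := by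
  have hexpm : Measurable fun b => Real.exp (Z b ^ 2 / s ^ 2) := by fun_prop
  have hexpi : Integrable (fun b => Real.exp (Z b ^ 2 / s ^ 2)) κ := by
    refine ⟨hexpm.aestronglyMeasurable, ?_⟩
    rw [hasFiniteIntegral_iff_ofReal (Filter.Eventually.of_forall fun b => (Real.exp_pos _).le)]
    exact hsub.trans_lt (by simp)
  have hexp2 : ∫ b, Real.exp (Z b ^ 2 / s ^ 2) ∂κ ≤ 2 := by
    rw [integral_eq_lintegral_of_nonneg_ae
      (Filter.Eventually.of_forall fun b => (Real.exp_pos _).le) hexpm.aestronglyMeasurable]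
    exact (ENNReal.toReal_mono (by simp) hsub).trans (by simp)
  have hZ2p : ∀ b, Z b ^ 2 ≤ s ^ 2 * (Real.exp (Z b ^ 2 / s ^ 2) - 1) := fun b => by
    have := Real.add_one_le_exp (Z b ^ 2 / s ^ 2)
    calc Z b ^ 2 = s ^ 2 * (Z b ^ 2 / s ^ 2) := by field_simp
      _ ≤ _ := by gcongr; linarith
  have hZ4p : ∀ b, Z b ^ 4 ≤ 2 * s ^ 4 * (Real.exp (Z b ^ 2 / s ^ 2) - 1) := fun b => by
    have := Real.quadratic_le_exp_of_nonneg (x := Z b ^ 2 / s ^ 2) (by positivity)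
    have h0 : 0 ≤ Z b ^ 2 / s ^ 2 := by positivity
    calc Z b ^ 4 = 2 * s ^ 4 * ((Z b ^ 2 / s ^ 2) ^ 2 / 2) := by field_simp
      _ ≤ _ := by gcongr; linarith
  have hZ2i : Integrable (fun b => Z b ^ 2) κ :=
    ((hexpi.sub (integrable_const 1)).const_mul (s ^ 2)).mono' (by fun_prop)
      (Filter.Eventually.of_forall fun b => by
        rw [Real.norm_of_nonneg (by positivity)]; exact hZ2p b)
  have hZ4i : Integrable (fun b => Z b ^ 4) κ :=
    ((hexpi.sub (integrable_const 1)).const_mul (2 * s ^ 4)).mono' (by fun_prop)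
      (Filter.Eventually.of_forall fun b => by
        rw [Real.norm_of_nonneg (by positivity)]; exact hZ4p b)
  have hE1 : ∫ b, (Real.exp (Z b ^ 2 / s ^ 2) - 1) ∂κ ≤ 1 := by
    rw [integral_sub hexpi (integrable_const 1)]; simp; linarith
  have hE2 : ∫ b, Z b ^ 2 ∂κ ≤ s ^ 2 := by
    refine (integral_mono hZ2i ((hexpi.sub (integrable_const 1)).const_mul (s ^ 2)) hZ2p).trans ?_
    simp only [Pi.sub_apply]
    rw [integral_const_mul]
    nlinarith [sq_nonneg s]
  have hE4 : ∫ b, Z b ^ 4 ∂κ ≤ 2 * s ^ 4 := by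
    refine (integral_mono hZ4i
      ((hexpi.sub (integrable_const 1)).const_mul (2 * s ^ 4)) hZ4p).trans ?_
    simp only [Pi.sub_apply]
    rw [integral_const_mul]
    nlinarith [pow_pos hs 4]
  have hls : lam ≤ s := by
    have h1 := hnd 0
    simp only [zero_add] at h1
    exact (pow_le_pow_iff_left₀ hlam.le hs.le two_ne_zero).1 (h1.trans hE2)
  refine ⟨hls, fun a => ?_⟩
  have hSm : MeasurableSet {b | lam / 2 ≤ |a + Z b|} :=
    measurableSet_le measurable_const (by fun_prop)
  set P := κ.real {b | lam / 2 ≤ |a + Z b|} with hP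
  have hind : ∫ b, Set.indicator {b | lam / 2 ≤ |a + Z b|} (fun _ => (1 : ℝ)) b ∂κ = P := by
    rw [integral_indicator_const _ hSm]; simp [hP]
  have hindi : Integrable (Set.indicator {b | lam / 2 ≤ |a + Z b|} (fun _ => (1 : ℝ))) κ :=
    (integrable_const 1).indicator hSm
  rcases le_or_gt (2 * s) |a| with ha | ha
  · -- a large shift cannot be cancelled, since `|Z|` rarely exceeds `3 s / 2`
    have hpt : ∀ b, 1 ≤ Set.indicator {b | lam / 2 ≤ |a + Z b|} (fun _ => (1 : ℝ)) b
        + (4 / 9 / s ^ 2) * Z b ^ 2 := by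
      intro b
      by_cases hb : lam / 2 ≤ |a + Z b|
      · rw [Set.indicator_of_mem (by exact hb)]
        have : 0 ≤ (4 / 9 / s ^ 2) * Z b ^ 2 := by positivity
        linarith
      · rw [Set.indicator_of_notMem (by exact hb), zero_add]
        have h1 : |a| ≤ |a + Z b| + |Z b| := by
          simpa using abs_sub (a + Z b) (Z b)
        have h2 : 3 / 2 * s ≤ |Z b| := by linarith
        have h3 : (3 / 2 * s) ^ 2 ≤ Z b ^ 2 := by
          rw [← sq_abs (Z b)]; gcongr
        have : (4 / 9 / s ^ 2) * (3 / 2 * s) ^ 2 = 1 := by field_simp; norm_num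
        rw [← this]; gcongr
    have h := integral_mono (integrable_const 1) (hindi.add (hZ2i.const_mul (4 / 9 / s ^ 2))) hpt
    simp only [Pi.add_apply] at h
    rw [integral_add hindi (hZ2i.const_mul _), integral_const_mul, hind] at h
    simp only [integral_const, probReal_univ, smul_eq_mul, mul_one] at h
    have h4 : 4 / 9 / s ^ 2 * ∫ b, Z b ^ 2 ∂κ ≤ 4 / 9 := by
      calc _ ≤ 4 / 9 / s ^ 2 * s ^ 2 := by gcongr
        _ = 4 / 9 := by field_simp
    have h5 : (lam / s) ^ 4 ≤ 1 := pow_le_one₀ (by positivity) ((div_le_one hs).2 hls)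
    linarith
  · set α := lam ^ 2 / (288 * s ^ 4) with hα
    have hα0 : 0 < α := by positivity
    have hpt : ∀ b, (a + Z b) ^ 2 ≤ (lam ^ 2 / 4 + 4 * α * (16 * s ^ 4) + 4 * α * Z b ^ 4)
        + (1 / (2 * α)) * Set.indicator {b | lam / 2 ≤ |a + Z b|} (fun _ => (1 : ℝ)) b := by
      intro b
      have h4 : (a + Z b) ^ 4 ≤ 8 * (16 * s ^ 4 + Z b ^ 4) := by
        have ha2 : a ^ 2 ≤ 4 * s ^ 2 := by rw [← sq_abs]; nlinarith [abs_nonneg a]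
        have ha4 : a ^ 4 ≤ 16 * s ^ 4 := by nlinarith [sq_nonneg a, sq_nonneg s]
        nlinarith [sq_nonneg (a ^ 2 - Z b ^ 2), sq_nonneg (a - Z b), sq_nonneg (a + Z b),
          mul_nonneg (sq_nonneg (a - Z b)) (sq_nonneg (a + Z b)), sq_nonneg ((a - Z b) ^ 2)]
      have hq : 0 ≤ 4 * α * (16 * s ^ 4) + 4 * α * Z b ^ 4 := by positivity
      by_cases hb : lam / 2 ≤ |a + Z b|
      · rw [Set.indicator_of_mem (by exact hb)]
        have h5 : (a + Z b) ^ 2 ≤ α / 2 * (a + Z b) ^ 4 + 1 / (2 * α) := by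
          have : 0 ≤ (α * (a + Z b) ^ 2 - 1) ^ 2 / (2 * α) := by positivity
          have e : (α * (a + Z b) ^ 2 - 1) ^ 2 / (2 * α)
              = α / 2 * (a + Z b) ^ 4 + 1 / (2 * α) - (a + Z b) ^ 2 := by field_simp; ring
          linarith
        have h6 : α / 2 * (a + Z b) ^ 4 ≤ α / 2 * (8 * (16 * s ^ 4 + Z b ^ 4)) := by gcongr
        nlinarith [sq_nonneg lam]
      · rw [Set.indicator_of_notMem (by exact hb), mul_zero, add_zero]
        have : (a + Z b) ^ 2 ≤ (lam / 2) ^ 2 := by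
          rw [← sq_abs (a + Z b)]
          exact pow_le_pow_left₀ (abs_nonneg _) (not_le.1 hb).le 2
        linarith
    have hsq : Integrable (fun b => (a + Z b) ^ 2) κ := by
      refine (((integrable_const (2 * a ^ 2)).add (hZ2i.const_mul 2))).mono' (by fun_prop)
        (Filter.Eventually.of_forall fun b => ?_)
      rw [Real.norm_of_nonneg (by positivity)]
      simp only [Pi.add_apply]
      nlinarith [sq_nonneg (a - Z b)]
    have hmid : Integrable
        (fun b => lam ^ 2 / 4 + 4 * α * (16 * s ^ 4) + 4 * α * Z b ^ 4) κ :=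
      (integrable_const _).add (hZ4i.const_mul (4 * α))
    have h := (hnd a).trans (integral_mono hsq (hmid.add (hindi.const_mul (1 / (2 * α)))) hpt)
    simp only [Pi.add_apply] at h
    rw [integral_add hmid (hindi.const_mul _), integral_add (integrable_const _) (hZ4i.const_mul _), integral_const_mul,
      integral_const_mul, hind] at h
    simp only [integral_const, probReal_univ, smul_eq_mul, one_mul] at h
    have h7 : 4 * α * ∫ b, Z b ^ 4 ∂κ ≤ 4 * α * (2 * s ^ 4) := by gcongr
    have h8 : 4 * α * (16 * s ^ 4) + 4 * α * (2 * s ^ 4) = lam ^ 2 / 4 := by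
      rw [hα]; field_simp; norm_num
    have h9 : lam ^ 2 / 2 ≤ 1 / (2 * α) * P := by linarith
    have h10 : (lam / s) ^ 4 / 288 = 2 * α * (lam ^ 2 / 2) := by rw [hα]; field_simp
    rw [h10]
    calc 2 * α * (lam ^ 2 / 2) ≤ 2 * α * (1 / (2 * α) * P) := by gcongr
      _ = P := by field_simp

/-- The small-ball estimate in exponential form. -/
lemma lintegral_exp_neg_abs_le {S : Type*} [MeasurableSpace S] {κ : Measure S}
    [IsProbabilityMeasure κ] {Y : S → ℝ} (hY : Measurable Y) {lam c : ℝ} (hlam : 0 < lam)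
    (hc : c ≤ κ.real {b | lam / 2 ≤ |Y b|}) :
    ∫⁻ b, ENNReal.ofReal (Real.exp (-(2 / lam * |Y b|))) ∂κ ≤ ENNReal.ofReal (1 - c / 2) := by
  have hSm : MeasurableSet {b | lam / 2 ≤ |Y b|} := measurableSet_le measurable_const (by fun_prop)
  have hpt : ∀ b, Real.exp (-(2 / lam * |Y b|)) ≤
      1 - 1 / 2 * Set.indicator {b | lam / 2 ≤ |Y b|} (fun _ => (1 : ℝ)) b := by
    intro b
    by_cases hb : lam / 2 ≤ |Y b|
    · rw [Set.indicator_of_mem (by exact hb)]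
      have h1 : 1 ≤ 2 / lam * |Y b| := by
        calc (1 : ℝ) = 2 / lam * (lam / 2) := by field_simp
          _ ≤ _ := by gcongr
      have h2 : Real.exp (-(2 / lam * |Y b|)) ≤ Real.exp (-1) := Real.exp_le_exp.2 (by linarith)
      have h3 := Real.exp_neg_one_lt_half
      linarith
    · rw [Set.indicator_of_notMem (by exact hb)]
      simpa using by positivity
  have hi : Integrable (fun b => Real.exp (-(2 / lam * |Y b|))) κ := by
    refine (integrable_const (1 : ℝ)).mono' (by fun_prop) (Filter.Eventually.of_forall fun b => ?_)
    rw [Real.norm_of_nonneg (Real.exp_pos _).le]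
    exact Real.exp_le_one_iff.2 (neg_nonpos.2 (by positivity))
  have hindi : Integrable (Set.indicator {b | lam / 2 ≤ |Y b|} (fun _ => (1 : ℝ))) κ :=
    (integrable_const 1).indicator hSm
  rw [← ofReal_integral_eq_lintegral_ofReal hi
    (Filter.Eventually.of_forall fun b => (Real.exp_pos _).le)]
  refine ENNReal.ofReal_le_ofReal ?_
  refine (integral_mono hi ((integrable_const 1).sub (hindi.const_mul (1 / 2))) hpt).trans ?_
  simp only [Pi.sub_apply]
  rw [integral_sub (integrable_const _) (hindi.const_mul _), integral_const_mul,
    integral_indicator_const _ hSm]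
  simp
  linarith

/-! ### Exact recovery from a signed sum of projections -/

/-- The sign with which time `t` enters the recovery condition: `1` without attack (`w_t = 0`) and
`-1` at attack times. -/
noncomputable def attackSign {d : ℕ} (v : EuclideanSpace ℝ (Fin d)) : ℝ :=
  open Classical in if v = 0 then 1 else -1

lemma measurable_attackSign {d : ℕ} :
    Measurable (attackSign : EuclideanSpace ℝ (Fin d) → ℝ) := by
  classical
  unfold attackSign
  exact Measurable.ite (measurableSet_singleton 0) measurable_const measurable_const

lemma abs_attackSign {d : ℕ} (v : EuclideanSpace ℝ (Fin d)) : |attackSign v| = 1 := by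
  unfold attackSign; split_ifs <;> simp

/-- If along every direction the unattacked projections of the states outweigh the attacked ones,
then the true matrix is the unique minimizer: the objective splits into rows, and perturbing a
residual by `a` costs `|a|` when it is zero and gains at most `|a|` otherwise. -/
lemma lOneSolutions_eq_singleton {d : ℕ} (A : Matrix (Fin d) (Fin d) ℝ)
    (x₀ : EuclideanSpace ℝ (Fin d)) (w : ℕ → EuclideanSpace ℝ (Fin d)) (T : ℕ)
    (h : ∀ z : EuclideanSpace ℝ (Fin d), z ≠ 0 →
      0 < ∑ t ∈ Finset.range T, attackSign (w t) * |inner ℝ z (traj A x₀ w t)|) :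
    lOneSolutions (traj A x₀ w) T = {A} := by
  have hlt : ∀ B, B ≠ A → lOneLoss (traj A x₀ w) T A < lOneLoss (traj A x₀ w) T B := by
    intro B hB
    let row : Fin d → EuclideanSpace ℝ (Fin d) := fun i => WithLp.toLp 2 (fun j => A i j - B i j)
    have hres : ∀ t i, (traj A x₀ w (t + 1) - Matrix.toEuclideanCLM (𝕜 := ℝ) B (traj A x₀ w t)) i
        = w t i + inner ℝ (row i) (traj A x₀ w t) := by
      intro t i
      simp only [traj, PiLp.sub_apply, PiLp.add_apply, Matrix.ofLp_toEuclideanCLM, Matrix.mulVec,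
        dotProduct, PiLp.inner_apply, row, RCLike.inner_apply, conj_trivial, mul_sub,
        Finset.sum_sub_distrib]
      simp only [mul_comm]
      ring
    have hresA : ∀ t i, (traj A x₀ w (t + 1) - Matrix.toEuclideanCLM (𝕜 := ℝ) A (traj A x₀ w t)) i
        = w t i := by
      intro t i; simp [traj]
    have hpt : ∀ t i, |w t i| + attackSign (w t) * |inner ℝ (row i) (traj A x₀ w t)| ≤
        |w t i + inner ℝ (row i) (traj A x₀ w t)| := by
      intro t i
      unfold attackSign
      split_ifs with h0
      · simp [h0]
      · have := abs_sub (w t i + inner ℝ (row i) (traj A x₀ w t)) (inner ℝ (row i) (traj A x₀ w t))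
        rw [add_sub_cancel_right] at this
        linarith
    have hpos : 0 < ∑ i, ∑ t ∈ Finset.range T,
        attackSign (w t) * |inner ℝ (row i) (traj A x₀ w t)| := by
      obtain ⟨i, hi⟩ : ∃ i, row i ≠ 0 := by
        by_contra! hall
        refine hB (Matrix.ext fun i j => ?_)
        have := congrArg (fun v : EuclideanSpace ℝ (Fin d) => v j) (hall i)
        simp only [row, PiLp.zero_apply] at this
        linarith
      refine Finset.sum_pos' (fun k _ => ?_) ⟨i, Finset.mem_univ i, h _ hi⟩
      rcases eq_or_ne (row k) 0 with hk | hk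
      · simp [hk]
      · exact (h _ hk).le
    unfold lOneLoss
    simp only [hres, hresA]
    rw [Finset.sum_comm] at hpos
    have := Finset.sum_le_sum fun t (_ : t ∈ Finset.range T) =>
      Finset.sum_le_sum fun i (_ : i ∈ Finset.univ) => hpt t i
    simp only [Finset.sum_add_distrib] at this
    linarith
  ext B
  simp only [lOneSolutions, Set.mem_ofPred_eq, Set.mem_singleton_iff]
  constructor
  · intro hB
    by_contra hne
    exact absurd (hB A) (not_le.2 (hlt B hne))
  · rintro rfl B'
    rcases eq_or_ne B' B with rfl | hne
    · exact le_rfl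
    · exact (hlt B' hne).le

/-! ### Deterministic bounds along the trajectory -/

lemma sum_norm_traj_le {d : ℕ} (A : Matrix (Fin d) (Fin d) ℝ)
    (x₀ : EuclideanSpace ℝ (Fin d)) (w : ℕ → EuclideanSpace ℝ (Fin d)) (n : ℕ) :
    (1 - opNormTwo A) * ∑ t ∈ Finset.range n, ‖traj A x₀ w t‖ + ‖traj A x₀ w n‖
      ≤ ‖x₀‖ + ∑ t ∈ Finset.range n, ‖w t‖ := by
  induction n with
  | zero => simp [traj]
  | succ n ih =>
    rw [Finset.sum_range_succ, Finset.sum_range_succ]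
    have h1 : ‖traj A x₀ w (n + 1)‖ ≤ opNormTwo A * ‖traj A x₀ w n‖ + ‖w n‖ :=
      (norm_add_le _ _).trans (add_le_add_left (ContinuousLinearMap.le_opNorm _ _) _)
    linarith

/-- The weighted energy `∑_{k < H} r⁻ᵏ ⟪z, Bᵏ v⟫²`, a finite-horizon Lyapunov function for the
projections on `z` of the orbit of `v` under `B`. -/
noncomputable def weightedEnergy {d : ℕ}
    (B : EuclideanSpace ℝ (Fin d) →L[ℝ] EuclideanSpace ℝ (Fin d)) (z : EuclideanSpace ℝ (Fin d))
    (r : ℝ) (H : ℕ) (v : EuclideanSpace ℝ (Fin d)) : ℝ :=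
  ∑ k ∈ Finset.range H, (r ^ k)⁻¹ * (inner ℝ z ((B ^ k) v)) ^ 2

lemma measurable_weightedEnergy {d : ℕ}
    (B : EuclideanSpace ℝ (Fin d) →L[ℝ] EuclideanSpace ℝ (Fin d)) (z : EuclideanSpace ℝ (Fin d))
    (r : ℝ) (H : ℕ) : Measurable (weightedEnergy B z r H) := by
  unfold weightedEnergy
  refine Finset.measurable_fun_sum _ fun k _ => ?_
  have : Continuous fun v => (r ^ k)⁻¹ * (inner ℝ z ((B ^ k) v)) ^ 2 := by fun_prop
  exact this.measurable

lemma sq_add_le_div {r : ℝ} (hr : 0 < r) (hr1 : r < 1) (a b : ℝ) :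
    (a + b) ^ 2 ≤ r⁻¹ * a ^ 2 + (1 - r)⁻¹ * b ^ 2 := by
  have h1 : 0 < 1 - r := by linarith
  have e : r⁻¹ * a ^ 2 + (1 - r)⁻¹ * b ^ 2 - (a + b) ^ 2
      = ((1 - r) * a - r * b) ^ 2 / (r * (1 - r)) := by field_simp; ring
  have : 0 ≤ ((1 - r) * a - r * b) ^ 2 / (r * (1 - r)) := by positivity
  linarith

lemma sum_sq_inner_traj_le {d : ℕ} (A : Matrix (Fin d) (Fin d) ℝ)
    (x₀ : EuclideanSpace ℝ (Fin d)) (w : ℕ → EuclideanSpace ℝ (Fin d))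
    (z : EuclideanSpace ℝ (Fin d)) {r : ℝ} (hr : 0 < r) (hr1 : r < 1) (n H : ℕ) :
    ∑ t ∈ Finset.range n, (inner ℝ z (traj A x₀ w t)) ^ 2
        + weightedEnergy (Matrix.toEuclideanCLM (𝕜 := ℝ) A) z r H (traj A x₀ w n)
      ≤ weightedEnergy (Matrix.toEuclideanCLM (𝕜 := ℝ) A) z r (H + n) x₀
        + (1 - r)⁻¹ * ∑ t ∈ Finset.range n,
          weightedEnergy (Matrix.toEuclideanCLM (𝕜 := ℝ) A) z r (H + n) (w t) := by
  set B := Matrix.toEuclideanCLM (𝕜 := ℝ) A with hB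
  have h1r : 0 < 1 - r := by linarith
  induction n generalizing H with
  | zero => simp [traj]
  | succ n ih =>
    have ih' := ih (H + 1)
    have hHn : H + 1 + n = H + (n + 1) := by omega
    rw [hHn] at ih'
    -- one step of the dynamics shifts the energy by one power of `B`
    have hstep : weightedEnergy B z r H (traj A x₀ w (n + 1))
        + (inner ℝ z (traj A x₀ w n)) ^ 2 ≤ weightedEnergy B z r (H + 1) (traj A x₀ w n)
          + (1 - r)⁻¹ * weightedEnergy B z r H (w n) := by
      unfold weightedEnergy
      rw [Finset.sum_range_succ' _ H, Finset.mul_sum]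
      have hk : ∀ k ∈ Finset.range H,
          (r ^ k)⁻¹ * (inner ℝ z ((B ^ k) (traj A x₀ w (n + 1)))) ^ 2 ≤
          (r ^ (k + 1))⁻¹ * (inner ℝ z ((B ^ (k + 1)) (traj A x₀ w n))) ^ 2
            + (1 - r)⁻¹ * ((r ^ k)⁻¹ * (inner ℝ z ((B ^ k) (w n))) ^ 2) := by
        intro k _
        have e : (B ^ k) (traj A x₀ w (n + 1)) = (B ^ (k + 1)) (traj A x₀ w n) + (B ^ k) (w n) := by
          rw [traj, map_add, pow_succ]; rfl
        rw [e, inner_add_right]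
        have h0 : 0 ≤ (r ^ k)⁻¹ := by positivity
        refine (mul_le_mul_of_nonneg_left (sq_add_le_div hr hr1 _ _) h0).trans (le_of_eq ?_)
        rw [pow_succ r k, mul_inv]; ring
      have := Finset.sum_le_sum hk
      rw [Finset.sum_add_distrib] at this
      simp only [pow_zero, inv_one, one_mul, one_apply_eq_self]
      linarith
    have hmono : weightedEnergy B z r H (w n) ≤ weightedEnergy B z r (H + (n + 1)) (w n) := by
      unfold weightedEnergy
      exact Finset.sum_le_sum_of_subset_of_nonneg
        (Finset.range_subset_range.2 (by omega)) fun k _ _ => by positivity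
    have hmono' := mul_le_mul_of_nonneg_left hmono (inv_nonneg.2 h1r.le)
    rw [Finset.sum_range_succ, Finset.sum_range_succ, mul_add]
    linarith

/-- The weighted energy of a sub-Gaussian vector has exponential moments at the dimension-free
scale `s ^ 2 / (1 - r)`. -/
lemma IsSubGaussianVec.lintegral_exp_weightedEnergy_le {S : Type*} [MeasurableSpace S] {d : ℕ}
    {X : S → EuclideanSpace ℝ (Fin d)} (hX : Measurable X) {ν : Measure S}
    [IsProbabilityMeasure ν] {s : ℝ} (h : IsSubGaussianVec X ν s)
    {B : EuclideanSpace ℝ (Fin d) →L[ℝ] EuclideanSpace ℝ (Fin d)} {r : ℝ} (hr : 0 < r)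
    (hr1 : r < 1) (hBr : ‖B‖ ≤ r) {z : EuclideanSpace ℝ (Fin d)} (hz : ‖z‖ ≤ 1) (H : ℕ) :
    ∫⁻ b, ENNReal.ofReal (Real.exp ((1 - r) / s ^ 2 * weightedEnergy B z r H (X b))) ∂ν ≤ 2 := by
  have h1r : 0 < 1 - r := by linarith
  have hk := h.lintegral_exp_sum_le hX (Finset.range H) (a := fun k => (1 - r) * r ^ k)
    (fun k _ => by positivity)
    (by
      rw [← Finset.mul_sum, mul_neg_geom_sum]
      linarith [pow_nonneg hr.le H])
    (y := fun k => (r ^ k)⁻¹ • (ContinuousLinearMap.adjoint (B ^ k)) z)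
    (fun k _ => by
      rw [norm_smul, Real.norm_of_nonneg (by positivity)]
      have h2 : ‖(ContinuousLinearMap.adjoint (B ^ k)) z‖ ≤ r ^ k := by
        calc _ ≤ ‖ContinuousLinearMap.adjoint (B ^ k)‖ * ‖z‖ := ContinuousLinearMap.le_opNorm _ _
          _ ≤ ‖ContinuousLinearMap.adjoint (B ^ k)‖ * 1 := by gcongr
          _ = ‖B ^ k‖ := by rw [mul_one, LinearIsometryEquiv.norm_map]
          _ ≤ r ^ k := by
            rcases Nat.eq_zero_or_pos k with rfl | hk
            · rw [pow_zero, pow_zero]; exact ContinuousLinearMap.norm_id_le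
            · exact (norm_pow_le' B hk).trans (by gcongr)
      calc _ ≤ (r ^ k)⁻¹ * r ^ k := by gcongr
        _ = 1 := inv_mul_cancel₀ (by positivity))
  refine le_of_eq_of_le (lintegral_congr fun b => ?_) hk
  unfold weightedEnergy
  rw [Finset.mul_sum]
  congr 2
  refine Finset.sum_congr rfl fun k _ => ?_
  rw [real_inner_smul_right, ContinuousLinearMap.adjoint_inner_right, real_inner_comm]
  have : r ^ k ≠ 0 := by positivity
  field_simp

/-! ### A net of directions -/

lemma norm_le_of_abs_coord_le {d : ℕ} (v : EuclideanSpace ℝ (Fin d)) {b : ℝ} (hb : 0 ≤ b)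
    (h : ∀ i, |v i| ≤ b) : ‖v‖ ≤ d * b := by
  have h1 : ‖v‖ ^ 2 ≤ (d * b) ^ 2 := by
    rw [EuclideanSpace.norm_sq_eq]
    calc ∑ i, ‖v i‖ ^ 2 ≤ ∑ _i : Fin d, b ^ 2 :=
          Finset.sum_le_sum fun i _ => pow_le_pow_left₀ (norm_nonneg _) (h i) 2
      _ = d * b ^ 2 := by simp
      _ ≤ (d * b) ^ 2 := by
        rw [mul_pow]
        gcongr
        exact_mod_cast Nat.le_self_pow two_ne_zero d
  exact (pow_le_pow_iff_left₀ (norm_nonneg _) (by positivity) two_ne_zero).1 h1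

/-- Normalized integer points of a cube form a net of the unit sphere. -/
lemma exists_direction_net (d m : ℕ) (hm : d < m) :
    ∃ N : Finset (EuclideanSpace ℝ (Fin d)), N.card ≤ (2 * m + 1) ^ d ∧ (∀ z ∈ N, ‖z‖ = 1) ∧
      ∀ v : EuclideanSpace ℝ (Fin d), ‖v‖ = 1 → ∃ z ∈ N, ‖v - z‖ ≤ 2 * d / m := by
  classical
  let P : Finset (Fin d → ℤ) := Fintype.piFinset fun _ => Finset.Icc (-(m : ℤ)) m
  let e : (Fin d → ℤ) → EuclideanSpace ℝ (Fin d) := fun k => WithLp.toLp 2 fun i => (k i : ℝ)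
  have hm0 : (0 : ℝ) < m := by exact_mod_cast (Nat.zero_le d).trans_lt hm
  refine ⟨(P.image fun k => ‖e k‖⁻¹ • e k).filter fun z => ‖z‖ = 1, ?_, ?_, ?_⟩
  · refine (Finset.card_filter_le _ _).trans (Finset.card_image_le.trans (le_of_eq ?_))
    rw [Fintype.card_piFinset]
    simp only [Int.card_Icc, Finset.prod_const, Finset.card_univ, Fintype.card_fin]
    congr 1
    omega
  · exact fun z hz => (Finset.mem_filter.1 hz).2
  · intro v hv
    let k : Fin d → ℤ := fun i => ⌊m * v i⌋
    have hvi : ∀ i, |v i| ≤ 1 := fun i => by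
      simpa [hv] using PiLp.norm_apply_le v i
    have hkP : k ∈ P := by
      refine Fintype.mem_piFinset.2 fun i => Finset.mem_Icc.2 ⟨Int.le_floor.2 ?_, ?_⟩
      · push_cast
        nlinarith [(abs_le.1 (hvi i)).1]
      · have : ((k i : ℤ) : ℝ) ≤ m :=
          (Int.floor_le _).trans (by nlinarith [(abs_le.1 (hvi i)).2])
        exact_mod_cast this
    have hd : ‖(m : ℝ) • v - e k‖ ≤ d := by
      have := norm_le_of_abs_coord_le ((m : ℝ) • v - e k) zero_le_one fun i => by
        simp only [PiLp.sub_apply, PiLp.smul_apply, smul_eq_mul, e, k]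
        rw [abs_of_nonneg (by linarith [Int.floor_le (m * v i)])]
        linarith [Int.lt_floor_add_one (m * v i)]
      simpa using this
    have hmv : ‖(m : ℝ) • v‖ = m := by rw [norm_smul, hv, mul_one, Real.norm_of_nonneg hm0.le]
    have hdiff : |(m : ℝ) - ‖e k‖| ≤ d := by
      have := (abs_norm_sub_norm_le ((m : ℝ) • v) (e k)).trans hd
      rwa [hmv] at this
    have hek : 0 < ‖e k‖ := by
      have h1 := (abs_le.1 hdiff).2
      have h2 : (d : ℝ) < m := by exact_mod_cast hm
      linarith
    refine ⟨‖e k‖⁻¹ • e k, Finset.mem_filter.2 ⟨Finset.mem_image_of_mem _ hkP, ?_⟩, ?_⟩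
    · rw [norm_smul, norm_inv, norm_norm, inv_mul_cancel₀ hek.ne']
    · have e1 : v - ‖e k‖⁻¹ • e k =
          (m : ℝ)⁻¹ • (((m : ℝ) • v - e k) + (1 - m * ‖e k‖⁻¹) • e k) := by
        rw [smul_add, smul_sub, smul_smul, inv_mul_cancel₀ hm0.ne', one_smul, smul_smul, mul_sub,
          ← mul_assoc, inv_mul_cancel₀ hm0.ne', sub_smul, mul_one, one_mul]
        abel
      have e2 : ‖(1 - m * ‖e k‖⁻¹) • e k‖ = |(m : ℝ) - ‖e k‖| := by
        rw [norm_smul, Real.norm_eq_abs, ← abs_norm (e k), ← abs_mul, abs_norm, sub_mul, mul_assoc,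
          inv_mul_cancel₀ hek.ne', one_mul, mul_one, abs_sub_comm]
      rw [e1, norm_smul, norm_inv, Real.norm_of_nonneg hm0.le, inv_mul_eq_div]
      gcongr
      refine (norm_add_le _ _).trans ?_
      rw [e2]
      linarith

/-! ### A fixed direction -/

section FixedDirection

variable {Ω : Type*} [MeasurableSpace Ω] {d : ℕ} (μ : Measure Ω) [IsProbabilityMeasure μ]
  (A : Matrix (Fin d) (Fin d) ℝ) {x₀ : Ω → EuclideanSpace ℝ (Fin d)}
  {w : ℕ → Ω → EuclideanSpace ℝ (Fin d)} {p : ℝ}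

instance isProbabilityMeasure_disturbanceLaw (x₀ : Ω → EuclideanSpace ℝ (Fin d))
    (w : ℕ → Ω → EuclideanSpace ℝ (Fin d)) (t : ℕ) (ω : Ω) :
    IsProbabilityMeasure (disturbanceLaw μ x₀ w t ω) := by
  unfold disturbanceLaw; infer_instance

/-- The signed sum of projections is at least its drift minus a quadratic variation term. -/
lemma measure_signed_sum_le (hx₀ : Measurable x₀) (hw : ∀ t, Measurable (w t)) (hp : 0 < p)
    (hp1 : p ≤ 1) (hatt : HasAttackProbability μ x₀ w p) (z : EuclideanSpace ℝ (Fin d))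
    (η : ℝ) (T : ℕ) (L : ℝ) :
    μ {ω | L ≤ ∑ t ∈ Finset.range T,
        ((1 - 2 * p) * (η * |inner ℝ z (traj A (x₀ ω) (fun k => w k ω) t)|)
          - attackSign (w t ω) * (η * |inner ℝ z (traj A (x₀ ω) (fun k => w k ω) t)|)
          - 4 * (η * |inner ℝ z (traj A (x₀ ω) (fun k => w k ω) t)|) ^ 2)}
      ≤ ENNReal.ofReal (Real.exp (-L)) := by
  have hm := measurable_attackSign (d := d)
  have := measure_le_of_exp_moment μ A hx₀ hw
    (g := fun q => (1 - 2 * p) * (η * |inner ℝ z q.1|) - attackSign q.2 * (η * |inner ℝ z q.1|)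
      - 4 * (η * |inner ℝ z q.1|) ^ 2) (by fun_prop) (c := 0) (fun t => ?_)
    (g₀ := fun _ => 0) measurable_const (c₀ := 0) (by simp) T L
  · simpa using this
  · filter_upwards [hatt t] with ω hω
    set u := η * |inner ℝ z (traj A (x₀ ω) (fun k => w k ω) t)|
    have := isProbabilityMeasure_cond_of_attackProbability hp hp1 hω
    refine (lintegral_exp_le_of_attackProbability hp hp1 hω
      (a := (1 - 2 * p) * u - u - 4 * u ^ 2) (K := Real.exp ((1 - 2 * p) * u + u - 4 * u ^ 2))
      (by simp [attackSign]) (Real.exp_pos _).le ?_).trans ?_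
    · calc _ ≤ ∫⁻ _, ENNReal.ofReal (Real.exp ((1 - 2 * p) * u + u - 4 * u ^ 2))
            ∂(ProbabilityTheory.cond (disturbanceLaw μ x₀ w t ω) {0}ᶜ) := by
            refine lintegral_mono_ae ?_
            filter_upwards [ae_cond_mem (μ := disturbanceLaw μ x₀ w t ω)
              (measurableSet_singleton (0 : EuclideanSpace ℝ (Fin d))).compl] with v hv
            rw [attackSign, if_neg (by simpa using hv)]
            simp
        _ = _ := by simp
    · rw [Real.exp_zero]
      exact ENNReal.ofReal_le_ofReal (sign_exp_moment_le hp.le hp1 u)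

lemma measure_weightedEnergy_le (hx₀ : Measurable x₀) (hw : ∀ t, Measurable (w t)) (hp : 0 < p)
    (hp1 : p ≤ 1) (hatt : HasAttackProbability μ x₀ w p) {s : ℝ}
    (hsub₀ : IsSubGaussianVec x₀ μ s)
    (hsub : ∀ t, ∀ᵐ ω ∂μ, IsSubGaussianVec (fun v => v) (attackLaw μ x₀ w t ω) s)
    {B : EuclideanSpace ℝ (Fin d) →L[ℝ] EuclideanSpace ℝ (Fin d)} {r : ℝ} (hr : 0 < r)
    (hr1 : r < 1) (hBr : ‖B‖ ≤ r) {z : EuclideanSpace ℝ (Fin d)} (hz : ‖z‖ ≤ 1) (T : ℕ) (L : ℝ) :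
    μ {ω | 1 + T * p + L ≤ (1 - r) / s ^ 2 * weightedEnergy B z r T (x₀ ω)
        + ∑ t ∈ Finset.range T, (1 - r) / s ^ 2 * weightedEnergy B z r T (w t ω)}
      ≤ ENNReal.ofReal (Real.exp (-L)) := by
  have hm := measurable_weightedEnergy B z r T
  -- the increments do not involve the state, so any dynamics will do
  refine measure_le_of_exp_moment μ 0 hx₀ hw
    (g := fun q => (1 - r) / s ^ 2 * weightedEnergy B z r T q.2) (by fun_prop) (fun t => ?_)
    (g₀ := fun x => (1 - r) / s ^ 2 * weightedEnergy B z r T x) (by fun_prop) ?_ T L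
  · filter_upwards [hatt t, hsub t] with ω hω hsω
    have : IsProbabilityMeasure (attackLaw μ x₀ w t ω) :=
      isProbabilityMeasure_cond_of_attackProbability hp hp1 hω
    refine (lintegral_exp_le_of_attackProbability hp hp1 hω (a := 0) (K := 2)
      (by simp [weightedEnergy]) (by norm_num) ?_).trans (ENNReal.ofReal_le_ofReal ?_)
    · rw [ENNReal.ofReal_ofNat]
      exact hsω.lintegral_exp_weightedEnergy_le measurable_id' hr hr1 hBr hz T
    · rw [Real.exp_zero]
      linarith [Real.add_one_le_exp p]
  · refine (hsub₀.lintegral_exp_weightedEnergy_le hx₀ hr hr1 hBr hz T).trans ?_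
    rw [← ENNReal.ofReal_ofNat]
    exact ENNReal.ofReal_le_ofReal (by linarith [Real.add_one_le_exp (1 : ℝ)])

/-- Each attack excites the direction `z` with positive probability, whatever the current state. -/
lemma measure_sum_abs_inner_le (hx₀ : Measurable x₀) (hw : ∀ t, Measurable (w t)) (hp : 0 < p)
    (hp1 : p ≤ 1) (hatt : HasAttackProbability μ x₀ w p) {lam c : ℝ} (hlam : 0 < lam)
    (z : EuclideanSpace ℝ (Fin d))
    (hc : ∀ t, ∀ᵐ ω ∂μ, ∀ a : ℝ,
      c ≤ (attackLaw μ x₀ w t ω).real {v | lam / 2 ≤ |a + inner ℝ z v|}) (n : ℕ) (L : ℝ) :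
    μ {ω | n * (-(p * c / 2)) + L ≤ ∑ t ∈ Finset.range n,
        (-(2 / lam * |inner ℝ z (traj A (x₀ ω) (fun k => w k ω) (t + 1))|))}
      ≤ ENNReal.ofReal (Real.exp (-L)) := by
  have := measure_le_of_exp_moment μ A hx₀ hw
    (g := fun q => -(2 / lam * |inner ℝ z (Matrix.toEuclideanCLM (𝕜 := ℝ) A q.1 + q.2)|))
    (by fun_prop) (c := -(p * c / 2)) (fun t => ?_)
    (g₀ := fun _ => 0) measurable_const (c₀ := 0) (by simp) n L
  · simpa [traj] using this
  · filter_upwards [hatt t, hc t] with ω hω hcω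
    have : IsProbabilityMeasure (attackLaw μ x₀ w t ω) :=
      isProbabilityMeasure_cond_of_attackProbability hp hp1 hω
    set x := Matrix.toEuclideanCLM (𝕜 := ℝ) A (traj A (x₀ ω) (fun k => w k ω) t)
    have hc' := hcω (inner ℝ z x)
    simp only [← inner_add_right] at hc'
    have hc1 : c ≤ 1 := hc'.trans measureReal_le_one
    refine (lintegral_exp_le_of_attackProbability hp hp1 hω (a := 0) (K := 1 - c / 2)
      ?_ (by linarith) ?_).trans (ENNReal.ofReal_le_ofReal ?_)
    · exact neg_nonpos.2 (by positivity)
    · exact lintegral_exp_neg_abs_le (κ := attackLaw μ x₀ w t ω) (by fun_prop) hlam hc'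
    · rw [Real.exp_zero]
      linarith [Real.add_one_le_exp (-(p * c / 2))]

lemma exp_moment_norm_le {S : Type*} [MeasurableSpace S] {X : S → EuclideanSpace ℝ (Fin d)}
    (hX : Measurable X) {ν : Measure S} [IsProbabilityMeasure ν] {s : ℝ}
    (h : IsSubGaussianVec X ν s) :
    ∫⁻ b, ENNReal.ofReal (Real.exp (‖X b‖ / (d * s))) ∂ν ≤ ENNReal.ofReal 3 := by
  have hexp : Real.exp (1 / 4) ≤ 3 / 2 := by
    refine (Real.exp_bound_div_one_sub_of_interval (by norm_num) (by norm_num)).trans ?_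
    norm_num
  have hpt : ∀ b, Real.exp (‖X b‖ / (d * s))
      ≤ Real.exp (1 / 4) * Real.exp (‖X b‖ ^ 2 / (d * s ^ 2)) := by
    intro b
    rw [← Real.exp_add, Real.exp_le_exp]
    have h1 : (‖X b‖ / (d * s)) ^ 2 ≤ ‖X b‖ ^ 2 / (d * s ^ 2) := by
      rcases Nat.eq_zero_or_pos d with hd | hd
      · simp [hd]
      rcases eq_or_ne s 0 with rfl | hs
      · simp
      have hd' : (1 : ℝ) ≤ d := by exact_mod_cast hd
      rw [div_pow, mul_pow]
      gcongr
      exact le_self_pow₀ hd' two_ne_zero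
    nlinarith [sq_nonneg (‖X b‖ / (d * s) - 1 / 2)]
  calc _ ≤ ∫⁻ b, ENNReal.ofReal (Real.exp (1 / 4)) *
        ENNReal.ofReal (Real.exp (‖X b‖ ^ 2 / (d * s ^ 2))) ∂ν := by
        refine lintegral_mono fun b => ?_
        rw [← ENNReal.ofReal_mul (Real.exp_pos _).le]
        exact ENNReal.ofReal_le_ofReal (hpt b)
    _ = ENNReal.ofReal (Real.exp (1 / 4)) *
        ∫⁻ b, ENNReal.ofReal (Real.exp (‖X b‖ ^ 2 / (d * s ^ 2))) ∂ν :=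
        lintegral_const_mul _ (by fun_prop)
    _ ≤ ENNReal.ofReal (3 / 2) * ENNReal.ofReal 2 := by
        refine mul_le_mul' (ENNReal.ofReal_le_ofReal hexp) ?_
        rw [ENNReal.ofReal_ofNat]
        exact h.lintegral_exp_norm_sq_le hX
    _ = ENNReal.ofReal 3 := by rw [← ENNReal.ofReal_mul (by norm_num)]; norm_num

lemma measure_sum_norm_le (hx₀ : Measurable x₀) (hw : ∀ t, Measurable (w t)) (hp : 0 < p)
    (hp1 : p ≤ 1) (hatt : HasAttackProbability μ x₀ w p) {s : ℝ}
    (hsub₀ : IsSubGaussianVec x₀ μ s)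
    (hsub : ∀ t, ∀ᵐ ω ∂μ, IsSubGaussianVec (fun v => v) (attackLaw μ x₀ w t ω) s)
    (T : ℕ) (L : ℝ) :
    μ {ω | 2 + T * (2 * p) + L ≤ ‖x₀ ω‖ / (d * s) + ∑ t ∈ Finset.range T, ‖w t ω‖ / (d * s)}
      ≤ ENNReal.ofReal (Real.exp (-L)) := by
  -- the increments do not involve the state, so any dynamics will do
  refine measure_le_of_exp_moment μ 0 hx₀ hw (g := fun q => ‖q.2‖ / (d * s)) (by fun_prop)
    (fun t => ?_) (g₀ := fun x => ‖x‖ / (d * s)) (by fun_prop) ?_ T L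
  · filter_upwards [hatt t, hsub t] with ω hω hsω
    have : IsProbabilityMeasure (attackLaw μ x₀ w t ω) :=
      isProbabilityMeasure_cond_of_attackProbability hp hp1 hω
    refine (lintegral_exp_le_of_attackProbability hp hp1 hω (a := 0) (K := 3)
      (by simp) (by norm_num) ?_).trans (ENNReal.ofReal_le_ofReal ?_)
    · exact exp_moment_norm_le (ν := attackLaw μ x₀ w t ω) measurable_id' hsω
    · rw [Real.exp_zero]
      linarith [Real.add_one_le_exp (2 * p)]
  · exact (exp_moment_norm_le hx₀ hsub₀).trans
      (ENNReal.ofReal_le_ofReal (by linarith [Real.add_one_le_exp (2 : ℝ)]))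

/-- The drift `q S` dominates the quadratic term and the deviation for a suitable `η`. -/
lemma gap_le_of_bounds {p q b c lam s L T S Q f η : ℝ} (hp : 0 < p) (hp1 : p ≤ 1) (hq : 0 < q)
    (hq1 : q ≤ 1) (hb : 0 < b) (hb1 : b ≤ 1) (hc : 0 < c) (hc1 : c ≤ 1) (hlam : 0 < lam)
    (hls : lam ≤ s) (hL : 1 ≤ L) (hT0 : 0 ≤ T)
    (hT : 49152 * L ≤ T * p * q ^ 2 * b ^ 2 * c ^ 2 * (lam / s) ^ 2)
    (hη : η = q * lam * c * b ^ 2 / (768 * s ^ 2))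
    (hS : lam / 2 * ((T - 1) * (p * c / 2) - L) ≤ S)
    (hQ : Q ≤ s ^ 2 / b ^ 2 * (1 + T * p + L))
    (hf : η * (q * S - f - 4 * η * Q) ≤ L) :
    q * lam * p * c * T / 32 ≤ f := by
  have hs : 0 < s := hlam.trans_le hls
  have hr0 : 0 < lam / s := div_pos hlam hs
  have hr1 : (lam / s) ^ 2 ≤ 1 := pow_le_one₀ hr0.le ((div_le_one hs).2 hls)
  have hη0 : 0 < η := by rw [hη]; positivity
  have hTpc : 49152 * L ≤ T * p * c := by
    refine hT.trans ?_
    have hc2 : c ^ 2 ≤ c := by nlinarith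
    calc T * p * q ^ 2 * b ^ 2 * c ^ 2 * (lam / s) ^ 2
        ≤ T * p * 1 * 1 * c * 1 := by
          gcongr
          · exact pow_le_one₀ hq.le hq1
          · exact pow_le_one₀ hb.le hb1
      _ = T * p * c := by ring
  have hTp : T * p * c ≤ T * p := mul_le_of_le_one_right (by positivity) hc1
  have hpc : p * c ≤ 1 := mul_le_one₀ hp1 hc.le hc1
  have hS' : lam * (T * p * c) / 8 ≤ S := by
    refine le_trans ?_ hS
    have : T * p * c / 4 ≤ (T - 1) * (p * c / 2) - L := by nlinarith
    nlinarith
  have hQ' : 4 * η * Q ≤ q * lam * (T * p * c) / 64 := by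
    calc 4 * η * Q ≤ 4 * η * (s ^ 2 / b ^ 2 * (3 * (T * p))) := by
          gcongr; refine hQ.trans ?_; gcongr; linarith
      _ = q * lam * (T * p * c) / 64 := by rw [hη]; field_simp; ring
  have hL' : L ≤ η * (q * lam * (T * p * c) / 64) := by
    have e : η * (q * lam * (T * p * c) / 64)
        = T * p * q ^ 2 * b ^ 2 * c ^ 2 * (lam / s) ^ 2 / 49152 := by
      rw [hη]; field_simp; ring
    rw [e]; linarith
  have h1 : q * S - f - 4 * η * Q ≤ q * lam * (T * p * c) / 64 :=
    le_of_mul_le_mul_left (hf.trans hL') hη0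
  have h2 : q * (lam * (T * p * c) / 8) ≤ q * S := by gcongr
  have h3 : 0 ≤ q * lam * (T * p * c) := by
    have : 0 ≤ T * p * c := by linarith
    positivity
  nlinarith

/-- Along a fixed direction the signed sum of projections is bounded below by a multiple of the
expected number of attacks. -/
lemma measure_signed_sum_lt_gap (hx₀ : Measurable x₀) (hw : ∀ t, Measurable (w t)) (hp : 0 < p)
    (hp2 : p < 1 / 2) (hatt : HasAttackProbability μ x₀ w p) {s : ℝ}
    (hsub₀ : IsSubGaussianVec x₀ μ s)
    (hsub : ∀ t, ∀ᵐ ω ∂μ, IsSubGaussianVec (fun v => v) (attackLaw μ x₀ w t ω) s)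
    {r : ℝ} (hr : 0 < r) (hr1 : r < 1) (hA : opNormTwo A ≤ r) {lam c : ℝ} (hlam : 0 < lam)
    (hls : lam ≤ s) (hc0 : 0 < c) (hc1 : c ≤ 1)
    {z : EuclideanSpace ℝ (Fin d)} (hz : ‖z‖ ≤ 1)
    (hc : ∀ t, ∀ᵐ ω ∂μ, ∀ a : ℝ,
      c ≤ (attackLaw μ x₀ w t ω).real {v | lam / 2 ≤ |a + inner ℝ z v|}) {T : ℕ} {L : ℝ}
    (hL : 1 ≤ L)
    (hT : 49152 * L ≤ T * p * (1 - 2 * p) ^ 2 * (1 - r) ^ 2 * c ^ 2 * (lam / s) ^ 2) :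
    μ {ω | ∑ t ∈ Finset.range T, attackSign (w t ω) *
        |inner ℝ z (traj A (x₀ ω) (fun k => w k ω) t)| < (1 - 2 * p) * lam * p * c * T / 32}
      ≤ 3 * ENNReal.ofReal (Real.exp (-L)) := by
  have hs : 0 < s := hlam.trans_le hls
  have hp1 : p ≤ 1 := by linarith
  have h1r : 0 < 1 - r := by linarith
  obtain ⟨n, rfl⟩ : ∃ n, T = n + 1 := by
    refine Nat.exists_eq_succ_of_ne_zero fun h0 => ?_
    rw [h0] at hT
    simp at hT
    linarith
  set η := (1 - 2 * p) * lam * c * (1 - r) ^ 2 / (768 * s ^ 2) with hη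
  have ha := measure_signed_sum_le μ A hx₀ hw hp hp1 hatt z η (n + 1) L
  have hb := measure_weightedEnergy_le μ hx₀ hw hp hp1 hatt hsub₀ hsub hr hr1 hA hz (n + 1) L
  have hc' := measure_sum_abs_inner_le μ A hx₀ hw hp hp1 hatt hlam z hc n L
  refine (measure_mono (fun ω hω => ?_)).trans (((measure_union_le _ _).trans
    (add_le_add ((measure_union_le _ _).trans (add_le_add ha hb)) hc')).trans (le_of_eq (by ring)))
  by_contra hnot
  simp only [Set.mem_union, Set.mem_ofPred_eq, not_or, not_le] at hnot hω
  obtain ⟨⟨h1, h2⟩, h3⟩ := hnot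
  refine absurd hω (not_lt.2 ?_)
  have hQ := sum_sq_inner_traj_le A (x₀ ω) (fun k => w k ω) z hr hr1 (n + 1) 0
  simp only [zero_add] at hQ
  refine gap_le_of_bounds (S := ∑ t ∈ Finset.range (n + 1),
      |inner ℝ z (traj A (x₀ ω) (fun k => w k ω) t)|)
    (Q := ∑ t ∈ Finset.range (n + 1), (inner ℝ z (traj A (x₀ ω) (fun k => w k ω) t)) ^ 2)
    hp hp1 (by linarith) (by linarith) h1r (by linarith) hc0 hc1 hlam hls hL (by positivity) hT hη
    ?_ ?_ ?_
  · rw [Finset.sum_neg_distrib, ← Finset.mul_sum] at h3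
    rw [Finset.sum_range_succ']
    have h4 : (n : ℝ) * (p * c / 2) - L ≤ 2 / lam * ∑ t ∈ Finset.range n,
        |inner ℝ z (traj A (x₀ ω) (fun k => w k ω) (t + 1))| := by linarith
    have h5 := mul_le_mul_of_nonneg_left h4 (half_pos hlam).le
    rw [← mul_assoc, show lam / 2 * (2 / lam) = 1 by field_simp, one_mul] at h5
    push_cast
    rw [add_sub_cancel_right]
    linarith [abs_nonneg (inner ℝ z (traj A (x₀ ω) (fun k => w k ω) 0))]
  · rw [← Finset.mul_sum, ← mul_add] at h2
    set U := weightedEnergy (Matrix.toEuclideanCLM (𝕜 := ℝ) A) z r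
    have hU0 : 0 ≤ U (n + 1) (x₀ ω) := Finset.sum_nonneg fun k _ => by positivity
    have hUn : U 0 (traj A (x₀ ω) (fun k => w k ω) (n + 1)) = 0 := by simp [U, weightedEnergy]
    have h1i : 1 ≤ (1 - r)⁻¹ := (one_le_inv₀ h1r).2 (by linarith)
    have h6 : ∑ t ∈ Finset.range (n + 1), (inner ℝ z (traj A (x₀ ω) (fun k => w k ω) t)) ^ 2
        ≤ (1 - r)⁻¹ * (U (n + 1) (x₀ ω) + ∑ t ∈ Finset.range (n + 1), U (n + 1) (w t ω)) := by
      rw [mul_add]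
      have := le_mul_of_one_le_left hU0 h1i
      linarith
    refine h6.trans ?_
    have e : ∀ Y : ℝ, (1 - r)⁻¹ * Y = s ^ 2 / (1 - r) ^ 2 * ((1 - r) / s ^ 2 * Y) := by
      intro Y; field_simp
    rw [e]
    gcongr
  · refine le_of_eq_of_le ?_ h1.le
    simp only [Finset.mul_sum, ← Finset.sum_sub_distrib]
    refine Finset.sum_congr rfl fun t _ => ?_
    rw [mul_pow η, sq_abs]
    ring

end FixedDirection

/-! ### Non-degenerate attacks and the union bound -/

lemma small_ball_of_shiftedSecondMoment {d : ℕ} {κ : Measure (EuclideanSpace ℝ (Fin d))}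
    [IsProbabilityMeasure κ] {s lam : ℝ} (hs : 0 < s) (hlam : 0 < lam)
    (hsub : IsSubGaussianVec (fun v => v) κ s)
    (hnd : ∀ x, (shiftedSecondMoment κ x - lam ^ 2 • (1 : Matrix (Fin d) (Fin d) ℝ)).PosSemidef)
    {z : EuclideanSpace ℝ (Fin d)} (hz : ‖z‖ = 1) :
    lam ≤ s ∧ ∀ a : ℝ, (lam / s) ^ 4 / 288 ≤ κ.real {v | lam / 2 ≤ |a + inner ℝ z v|} := by
  have hd : 0 < (d : ℝ) := by
    rcases Nat.eq_zero_or_pos d with rfl | hd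
    · rw [Subsingleton.elim z 0] at hz
      simp at hz
    · exact_mod_cast hd
  have hexpi : Integrable (fun v => Real.exp (‖v‖ ^ 2 / (d * s ^ 2))) κ := by
    refine ⟨by fun_prop, ?_⟩
    rw [hasFiniteIntegral_iff_ofReal (Filter.Eventually.of_forall fun b => (Real.exp_pos _).le)]
    exact (hsub.lintegral_exp_norm_sq_le measurable_id').trans_lt (by simp)
  have hnormi : Integrable (fun v : EuclideanSpace ℝ (Fin d) => ‖v‖ ^ 2) κ := by
    refine (hexpi.const_mul (d * s ^ 2)).mono' (by fun_prop)
      (Filter.Eventually.of_forall fun v => ?_)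
    rw [Real.norm_of_nonneg (by positivity)]
    have := Real.add_one_le_exp (‖v‖ ^ 2 / (d * s ^ 2))
    calc ‖v‖ ^ 2 = d * s ^ 2 * (‖v‖ ^ 2 / (d * s ^ 2)) := by field_simp
      _ ≤ _ := by gcongr; linarith
  refine small_ball_of_second_moment (by fun_prop) hs hlam ?_ fun a => ?_
  · simpa only [real_inner_comm] using hsub z hz.le
  · have hint : ∀ i j, Integrable (fun v => ((a • z + v) i * (a • z + v) j)) κ := by
      intro i j
      refine ((integrable_const (2 * ‖a • z‖ ^ 2)).add (hnormi.const_mul 2)).mono' (by fun_prop)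
        (Filter.Eventually.of_forall fun v => ?_)
      simp only [Pi.add_apply]
      rw [norm_mul]
      have h1 := PiLp.norm_apply_le (a • z + v) i
      have h2 := PiLp.norm_apply_le (a • z + v) j
      have h3 := norm_add_le (a • z) v
      have h4 := mul_le_mul (h1.trans h3) (h2.trans h3) (norm_nonneg _) (by positivity)
      nlinarith [sq_nonneg (‖a • z‖ - ‖v‖)]
    have hpsd := (hnd (a • z)).dotProduct_mulVec_nonneg (fun i => z i)
    have hzz : ∑ i, z i * z i = 1 := by
      have := EuclideanSpace.norm_sq_eq z
      rw [hz] at this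
      simpa [sq] using this.symm
    have hquad : ∑ i, z i * ∑ j, shiftedSecondMoment κ (a • z) i j * z j
        = ∫ v, (a + inner ℝ z v) ^ 2 ∂κ := by
      have e : ∀ v, (a + inner ℝ z v) ^ 2
          = ∑ i, ∑ j, z i * z j * ((a • z + v) i * (a • z + v) j) := by
        intro v
        have e1 : a + inner ℝ z v = ∑ i, z i * (a • z + v) i := by
          have : inner ℝ z (a • z + v) = a + inner ℝ z v := by
            rw [inner_add_right, inner_smul_right, real_inner_self_eq_norm_sq, hz]; simp
          rw [← this, PiLp.inner_apply]
          exact Finset.sum_congr rfl fun i _ => by simp [mul_comm]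
        rw [e1, sq, Finset.sum_mul_sum]
        exact Finset.sum_congr rfl fun i _ => Finset.sum_congr rfl fun j _ => by ring
      simp only [e]
      rw [integral_finsetSum _ fun i _ => integrable_finsetSum _ fun j _ =>
        (hint i j).const_mul _]
      refine Finset.sum_congr rfl fun i _ => ?_
      rw [integral_finsetSum _ fun j _ => (hint i j).const_mul _, Finset.mul_sum]
      refine Finset.sum_congr rfl fun j _ => ?_
      rw [integral_const_mul, shiftedSecondMoment, Matrix.of_apply]
      ring
    rw [← hquad]
    rw [Matrix.sub_mulVec, Matrix.smul_mulVec, Matrix.one_mulVec, dotProduct_sub,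
      dotProduct_smul] at hpsd
    simp only [dotProduct, Matrix.mulVec, Pi.star_apply, star_trivial, smul_eq_mul, hzz,
      mul_one] at hpsd
    linarith

/-- A function that is homogeneous and `M`-Lipschitz, and at least `G` on a net of the sphere of
mesh smaller than `G / M`, is positive away from the origin. -/
lemma pos_of_net {d : ℕ} {f : EuclideanSpace ℝ (Fin d) → ℝ} {M G : ℝ} {m : ℕ}
    (hhom : ∀ (a : ℝ) z, f (a • z) = |a| * f z) (hlip : ∀ u v, |f u - f v| ≤ M * ‖u - v‖)
    (hM : 0 ≤ M) {N : Finset (EuclideanSpace ℝ (Fin d))}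
    (hN : ∀ v : EuclideanSpace ℝ (Fin d), ‖v‖ = 1 → ∃ z ∈ N, ‖v - z‖ ≤ 2 * d / m)
    (hG : ∀ z ∈ N, G ≤ f z) (hMG : M * (2 * d / m) < G) {v : EuclideanSpace ℝ (Fin d)}
    (hv : v ≠ 0) : 0 < f v := by
  have hv0 : 0 < ‖v‖ := norm_pos_iff.2 hv
  obtain ⟨z, hz, hvz⟩ := hN (‖v‖⁻¹ • v) (by
    rw [norm_smul, norm_inv, norm_norm, inv_mul_cancel₀ hv0.ne'])
  have h1 := (abs_le.1 (hlip (‖v‖⁻¹ • v) z)).1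
  have h2 : M * ‖‖v‖⁻¹ • v - z‖ ≤ M * (2 * d / m) := by gcongr
  have h3 := hG z hz
  rw [hhom] at h1
  have h4 : 0 < |‖v‖⁻¹| * f v := by linarith
  exact pos_of_mul_pos_right h4 (abs_nonneg _)

lemma signed_sum_smul {d T : ℕ} (ε : ℕ → ℝ) (x : ℕ → EuclideanSpace ℝ (Fin d)) (a : ℝ)
    (z : EuclideanSpace ℝ (Fin d)) :
    ∑ t ∈ Finset.range T, ε t * |inner ℝ (a • z) (x t)|
      = |a| * ∑ t ∈ Finset.range T, ε t * |inner ℝ z (x t)| := by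
  rw [Finset.mul_sum]
  refine Finset.sum_congr rfl fun t _ => ?_
  rw [real_inner_smul_left, abs_mul]; ring

lemma abs_signed_sum_sub_le {d T : ℕ} {ε : ℕ → ℝ} (hε : ∀ t, |ε t| = 1)
    (x : ℕ → EuclideanSpace ℝ (Fin d)) (u v : EuclideanSpace ℝ (Fin d)) :
    |(∑ t ∈ Finset.range T, ε t * |inner ℝ u (x t)|)
        - (∑ t ∈ Finset.range T, ε t * |inner ℝ v (x t)|)|
      ≤ (∑ t ∈ Finset.range T, ‖x t‖) * ‖u - v‖ := by
  rw [← Finset.sum_sub_distrib, Finset.sum_mul]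
  refine (Finset.abs_sum_le_sum_abs _ _).trans (Finset.sum_le_sum fun t _ => ?_)
  rw [← mul_sub, abs_mul, hε, one_mul]
  refine (abs_abs_sub_abs_le_abs_sub _ _).trans ?_
  rw [← inner_sub_left, mul_comm]
  exact abs_real_inner_le_norm _ _

/-- The resolution of the net is polynomial in the parameters, so the union bound only costs a
factor `d * l` in the exponent. -/
lemma union_bound_le {d : ℕ} (hd : 0 < d) {τ q b δ l : ℝ} (hτ : 1 ≤ τ) (hq : 0 < q) (hq1 : q ≤ 1)
    (hb : 0 < b) (hb1 : b ≤ 1) (hδ : 0 < δ) (hδ1 : δ ≤ 1) (hl : 1 ≤ l)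
    (hX : d * τ / (δ * q * b) ≤ Real.exp (2 * l)) {m : ℕ}
    (hm : m = ⌊92160 * d ^ 2 * τ ^ 5 / (q * b)⌋₊ + 1) :
    (((2 * m + 1) ^ d : ℕ) : ℝ) * (3 * Real.exp (-(27 * d * l))) + Real.exp (-(27 * d * l))
      ≤ δ := by
  have hd1 : (1 : ℝ) ≤ d := by exact_mod_cast hd
  set X := d * τ / (δ * q * b) with hXdef
  have hdτ : 1 ≤ d * τ := one_le_mul_of_one_le_of_one_le hd1 hτ
  have hqb : q * b ≤ 1 := mul_le_one₀ hq1 hb.le hb1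
  have hδX : 1 / δ ≤ X := by
    rw [hXdef, mul_assoc, div_le_div_iff₀ hδ (by positivity)]
    nlinarith [mul_pos hδ (mul_pos hq hb)]
  have hX1 : 1 ≤ X := ((one_le_div hδ).2 hδ1).trans hδX
  have hres : d ^ 2 * τ ^ 5 / (q * b) ≤ X ^ 5 := by
    have hδqb : δ * q * b ≤ q * b := by nlinarith [mul_pos hq hb]
    have hδqb0 : 0 < δ * q * b := by positivity
    have h1 : d ^ 2 * τ ^ 5 / (q * b) ≤ (d * τ) ^ 5 / (δ * q * b) := by
      rw [mul_pow]
      gcongr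
      · norm_num
    refine h1.trans ?_
    rw [hXdef, div_pow]
    gcongr
    exact pow_le_of_le_one hδqb0.le (hδqb.trans hqb) (by norm_num)
  have h13 : (184323 : ℝ) ≤ Real.exp 13 := by
    have h1 := Real.exp_one_gt_d9
    have h2 : Real.exp 13 = Real.exp 1 ^ 13 := by rw [← Real.exp_nat_mul]; norm_num
    rw [h2]
    calc (184323 : ℝ) ≤ (2.7 : ℝ) ^ 13 := by norm_num
      _ ≤ _ := by gcongr; linarith
  have hm' : (2 * m + 1 : ℝ) ≤ Real.exp (23 * l) := by
    have h1 : (m : ℝ) ≤ 92160 * X ^ 5 + 1 := by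
      rw [hm]
      push_cast
      have := Nat.floor_le (a := 92160 * d ^ 2 * τ ^ 5 / (q * b)) (by positivity)
      have e : 92160 * (d : ℝ) ^ 2 * τ ^ 5 / (q * b) = 92160 * (d ^ 2 * τ ^ 5 / (q * b)) := by ring
      linarith
    have h2 : 1 ≤ X ^ 5 := one_le_pow₀ hX1
    calc (2 * m + 1 : ℝ) ≤ 184323 * X ^ 5 := by linarith
      _ ≤ Real.exp 13 * (Real.exp (2 * l)) ^ 5 := by gcongr
      _ = Real.exp (13 + 10 * l) := by
        rw [← Real.exp_nat_mul, ← Real.exp_add]; congr 1; push_cast; ring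
      _ ≤ Real.exp (23 * l) := Real.exp_le_exp.2 (by linarith)
  have hpow : (((2 * m + 1) ^ d : ℕ) : ℝ) ≤ Real.exp (23 * d * l) := by
    push_cast
    calc (2 * m + 1 : ℝ) ^ d ≤ Real.exp (23 * l) ^ d := by gcongr
      _ = Real.exp (23 * d * l) := by rw [← Real.exp_nat_mul]; congr 1; ring
  have hpow1 : (1 : ℝ) ≤ (((2 * m + 1) ^ d : ℕ) : ℝ) := by
    exact_mod_cast Nat.one_le_pow _ _ (by omega)
  have h4 : 4 ≤ Real.exp (2 * l) := by
    have h1 := Real.exp_one_gt_d9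
    have h2 : Real.exp 2 = Real.exp 1 ^ 2 := by rw [← Real.exp_nat_mul]; norm_num
    have h3 : Real.exp 2 ≤ Real.exp (2 * l) := Real.exp_le_exp.2 (by linarith)
    nlinarith
  have hδl : Real.exp (-(2 * l)) ≤ δ := by
    rw [Real.exp_neg, inv_le_comm₀ (Real.exp_pos _) hδ, ← one_div]
    exact hδX.trans hX
  have hpos := Real.exp_pos (-(27 * d * l))
  calc _ ≤ (((2 * m + 1) ^ d : ℕ) : ℝ) * (4 * Real.exp (-(27 * d * l))) := by nlinarith
    _ ≤ Real.exp (23 * d * l) * (Real.exp (2 * l) * Real.exp (-(27 * d * l))) := by gcongr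
    _ = Real.exp (2 * l - 4 * d * l) := by
      rw [← Real.exp_add, ← Real.exp_add]; congr 1; ring
    _ ≤ Real.exp (-(2 * l)) := Real.exp_le_exp.2 (by nlinarith)
    _ ≤ δ := hδl

/-- The mesh of the net is fine enough for the Lipschitz constant `M` of the signed sums. -/
lemma mesh_mul_lt_gap {d m : ℕ} (hd : 0 < d) {p q b lam s M T L : ℝ} (hp : 0 < p) (hq : 0 < q)
    (hb : 0 < b) (hlam : 0 < lam) (hs : 0 < s) (hL : 1 ≤ L) (hTp : L ≤ T * p)
    (hM : b * M ≤ d * s * (2 + T * (2 * p) + L))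
    (hm : m = ⌊92160 * d ^ 2 * (s / lam) ^ 5 / (q * b)⌋₊ + 1) :
    M * (2 * d / m) < q * lam * p * ((lam / s) ^ 4 / 288) * T / 32 := by
  have hd0 : (0 : ℝ) < d := by exact_mod_cast hd
  have hm0 : (0 : ℝ) < m := by rw [hm]; positivity
  have hTp0 : 0 < T * p := by linarith
  have hmlt : 92160 * d ^ 2 * (s / lam) ^ 5 / (q * b) < m := by
    rw [hm]; push_cast; exact Nat.lt_floor_add_one _
  have hM' : M ≤ d * s * (5 * (T * p)) / b := by
    rw [le_div_iff₀ hb, mul_comm]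
    refine hM.trans ?_
    gcongr
    linarith
  calc M * (2 * d / m) ≤ d * s * (5 * (T * p)) / b * (2 * d / m) := by gcongr
    _ = 10 * d ^ 2 * s * (T * p) / b / m := by ring
    _ < q * lam * p * ((lam / s) ^ 4 / 288) * T / 32 := by
      rw [div_lt_iff₀ hm0]
      calc 10 * d ^ 2 * s * (T * p) / b
          = q * lam * p * ((lam / s) ^ 4 / 288) / 32 *
            (92160 * d ^ 2 * (s / lam) ^ 5 / (q * b)) * T := by field_simp; ring
        _ < q * lam * p * ((lam / s) ^ 4 / 288) / 32 * m * T := by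
          have hT0 : 0 < T := pos_of_mul_pos_left hTp0 hp.le
          gcongr
        _ = _ := by ring

/-- Exact recovery at confidence level `δ`, with `s` a sub-Gaussian scale and `l` dominating the
logarithm of the parameters. -/
lemma measure_recovery_failure_le {Ω : Type*} [MeasurableSpace Ω] {d : ℕ} (hd : 0 < d)
    (μ : Measure Ω) [IsProbabilityMeasure μ] (A : Matrix (Fin d) (Fin d) ℝ)
    {x₀ : Ω → EuclideanSpace ℝ (Fin d)} {w : ℕ → Ω → EuclideanSpace ℝ (Fin d)}
    {p s lam δ l : ℝ} (hx₀ : Measurable x₀) (hw : ∀ t, Measurable (w t))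
    (hA : opNormTwo A < 1) (hp : 0 < p) (hp2 : p < 1 / 2) (hatt : HasAttackProbability μ x₀ w p)
    (hs : 0 < s) (hsub₀ : IsSubGaussianVec x₀ μ s)
    (hsub : ∀ t, ∀ᵐ ω ∂μ, IsSubGaussianVec (fun v => v) (attackLaw μ x₀ w t ω) s)
    (hlam : 0 < lam) (hnd : IsNondegenerate μ x₀ w lam) (hδ : 0 < δ) (hδ1 : δ ≤ 1) (hl : 1 ≤ l)
    (hX : d * (s / lam) / (δ * (1 - 2 * p) * (1 - opNormTwo A)) ≤ Real.exp (2 * l)) {T : ℕ}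
    (hT : 49152 * (27 * d * l) ≤ T * p * (1 - 2 * p) ^ 2 * ((1 - opNormTwo A) / 2) ^ 2
      * ((lam / s) ^ 4 / 288) ^ 2 * (lam / s) ^ 2) :
    μ {ω | lOneSolutions (traj A (x₀ ω) (fun t => w t ω)) T = {A}}ᶜ ≤ ENNReal.ofReal δ := by
  have hd1 : (1 : ℝ) ≤ d := by exact_mod_cast hd
  have hρ0 : 0 ≤ opNormTwo A := norm_nonneg _
  set c : ℝ := (lam / s) ^ 4 / 288 with hc
  set L : ℝ := 27 * d * l with hL
  have hL1 : 1 ≤ L := by nlinarith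
  have hball : ∀ t, ∀ᵐ ω ∂μ, ∀ z : EuclideanSpace ℝ (Fin d), ‖z‖ = 1 → lam ≤ s ∧
      ∀ a : ℝ, c ≤ (attackLaw μ x₀ w t ω).real {v | lam / 2 ≤ |a + inner ℝ z v|} := by
    intro t
    filter_upwards [hatt t, hsub t, hnd t] with ω h1 h2 h3 z hz
    have : IsProbabilityMeasure (attackLaw μ x₀ w t ω) :=
      isProbabilityMeasure_cond_of_attackProbability hp (by linarith) h1
    exact small_ball_of_shiftedSecondMoment hs hlam h2 h3 hz
  have hls : lam ≤ s := by
    obtain ⟨ω, hω⟩ := (hball 0).exists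
    exact (hω (EuclideanSpace.single ⟨0, hd⟩ 1) (by simp)).1
  have hr0 : 0 < lam / s := by positivity
  have hr1 : lam / s ≤ 1 := (div_le_one hs).2 hls
  have hc0 : 0 < c := by positivity
  have hc1 : c ≤ 1 := by
    have := pow_le_one₀ (n := 4) hr0.le hr1
    rw [hc]; linarith
  have hb0 : 0 < 1 - opNormTwo A := by linarith
  have hq0 : 0 < 1 - 2 * p := by linarith
  have hτ : 1 ≤ s / lam := (one_le_div hlam).2 hls
  have hTp : L ≤ T * p := by
    have h1 : T * p * (1 - 2 * p) ^ 2 * ((1 - opNormTwo A) / 2) ^ 2 * c ^ 2 * (lam / s) ^ 2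
        ≤ T * p * 1 * 1 * 1 * 1 := by
      gcongr
      · exact pow_le_one₀ hq0.le (by linarith)
      · exact pow_le_one₀ (by positivity) (by linarith)
      · exact pow_le_one₀ hc0.le hc1
      · exact pow_le_one₀ hr0.le hr1
    linarith
  obtain ⟨m, hm⟩ : ∃ m, m = ⌊92160 * (d : ℝ) ^ 2 * (s / lam) ^ 5 /
    ((1 - 2 * p) * (1 - opNormTwo A))⌋₊ + 1 := ⟨_, rfl⟩
  have hdm : d < m := by
    rw [hm, Nat.lt_succ_iff]
    refine Nat.le_floor ?_
    rw [le_div_iff₀ (by positivity)]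
    have h1 : (1 - 2 * p) * (1 - opNormTwo A) ≤ 1 :=
      mul_le_one₀ (by linarith) hb0.le (by linarith)
    have h2 : 1 ≤ (s / lam) ^ 5 := one_le_pow₀ hτ
    have h3 : (d : ℝ) ≤ d ^ 2 := le_self_pow₀ hd1 two_ne_zero
    calc (d : ℝ) * ((1 - 2 * p) * (1 - opNormTwo A)) ≤ d * 1 := by gcongr
      _ ≤ 92160 * d ^ 2 * 1 := by linarith
      _ ≤ 92160 * d ^ 2 * (s / lam) ^ 5 := by gcongr
  obtain ⟨N, hNcard, hNnorm, hNcover⟩ := exists_direction_net d m hdm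
  set bad : EuclideanSpace ℝ (Fin d) → Set Ω := fun z => {ω | ∑ t ∈ Finset.range T,
    attackSign (w t ω) * |inner ℝ z (traj A (x₀ ω) (fun k => w k ω) t)|
      < (1 - 2 * p) * lam * p * c * T / 32} with hbad
  have hbadz : ∀ z ∈ N, μ (bad z) ≤ 3 * ENNReal.ofReal (Real.exp (-L)) := by
    intro z hz
    refine measure_signed_sum_lt_gap μ A hx₀ hw hp hp2 hatt hsub₀ hsub
      (r := (1 + opNormTwo A) / 2) (by linarith) (by linarith) (by linarith) hlam hls hc0 hc1
      (hNnorm z hz).le (fun t => ?_) hL1 ?_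
    · filter_upwards [hball t] with ω hω
      exact (hω z (hNnorm z hz)).2
    · rwa [show 1 - (1 + opNormTwo A) / 2 = (1 - opNormTwo A) / 2 by ring]
  have hnorm := measure_sum_norm_le μ hx₀ hw hp (by linarith) hatt hsub₀ hsub T L
  have hincl : {ω | lOneSolutions (traj A (x₀ ω) (fun t => w t ω)) T = {A}}ᶜ ⊆
      (⋃ z ∈ N, bad z) ∪ {ω | 2 + T * (2 * p) + L ≤
        ‖x₀ ω‖ / (d * s) + ∑ t ∈ Finset.range T, ‖w t ω‖ / (d * s)} := by
    intro ω hω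
    by_contra hnot
    simp only [Set.mem_union, Set.mem_iUnion, not_or, not_exists, hbad, Set.mem_ofPred_eq, not_le,
      not_lt] at hnot
    refine hω (lOneSolutions_eq_singleton A _ _ T fun v hv => ?_)
    refine pos_of_net (f := fun v => ∑ t ∈ Finset.range T, attackSign (w t ω) *
        |inner ℝ v (traj A (x₀ ω) (fun k => w k ω) t)|)
      (signed_sum_smul _ _) (abs_signed_sum_sub_le (fun t => abs_attackSign _) _)
      (Finset.sum_nonneg fun t _ => norm_nonneg _) hNcover hnot.1
      (mesh_mul_lt_gap hd hp hq0 hb0 hlam hs hL1 hTp ?_ hm) hv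
    have h1 := sum_norm_traj_le A (x₀ ω) (fun k => w k ω) T
    have h2 := hnot.2
    rw [← Finset.sum_div, ← add_div, div_lt_iff₀ (by positivity)] at h2
    linarith [norm_nonneg (traj A (x₀ ω) (fun k => w k ω) T)]
  calc _ ≤ μ (⋃ z ∈ N, bad z) + μ {ω | 2 + T * (2 * p) + L ≤
        ‖x₀ ω‖ / (d * s) + ∑ t ∈ Finset.range T, ‖w t ω‖ / (d * s)} :=
        (measure_mono hincl).trans (measure_union_le _ _)
    _ ≤ ∑ z ∈ N, 3 * ENNReal.ofReal (Real.exp (-L)) + ENNReal.ofReal (Real.exp (-L)) :=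
        add_le_add ((measure_biUnion_finset_le _ _).trans (Finset.sum_le_sum hbadz)) hnorm
    _ ≤ ((2 * m + 1) ^ d : ℕ) * (3 * ENNReal.ofReal (Real.exp (-L)))
          + ENNReal.ofReal (Real.exp (-L)) := by
        rw [Finset.sum_const, nsmul_eq_mul]
        gcongr
    _ = ENNReal.ofReal ((((2 * m + 1) ^ d : ℕ) : ℝ) * (3 * Real.exp (-L)) + Real.exp (-L)) := by
        rw [ENNReal.ofReal_add (by positivity) (by positivity),
          ENNReal.ofReal_mul (by positivity), ENNReal.ofReal_mul (by norm_num),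
          ENNReal.ofReal_natCast, ENNReal.ofReal_ofNat]
    _ ≤ ENNReal.ofReal δ := ENNReal.ofReal_le_ofReal
        (union_bound_le hd hτ hq0 (by linarith) hb0 (by linarith) hδ hδ1 hl hX hm)

theorem theorem3 :
    ∃ C : ℝ, 0 < C ∧
      ∀ (d : ℕ) (Ω : Type*) [MeasurableSpace Ω] (μ : Measure Ω) [IsProbabilityMeasure μ]
        (A : Matrix (Fin d) (Fin d) ℝ)
        (x₀ : Ω → EuclideanSpace ℝ (Fin d)) (w : ℕ → Ω → EuclideanSpace ℝ (Fin d))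
        (σ lam p δ : ℝ),
        Measurable x₀ → (∀ t, Measurable (w t)) →
        opNormTwo A < 1 →
        0 < σ → HasSubGaussianBound μ x₀ w σ →
        0 < lam → IsNondegenerate μ x₀ w lam →
        0 < p → p < 1 / 2 → HasAttackProbability μ x₀ w p →
        0 < δ → δ ≤ 1 →
        ∀ T : ℕ,
          C * (d * max 1 ((σ / lam) ^ 10) / (p * (1 - 2 * p) ^ 2 * (1 - opNormTwo A) ^ 2)
            * max 1 (Real.log (d * (σ / lam) / (δ * (1 - 2 * p) * (1 - opNormTwo A))))) ≤ T →
          ENNReal.ofReal (1 - δ) ≤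
            μ {ω | lOneSolutions (traj A (x₀ ω) (fun t => w t ω)) T = {A}} := by
  -- `49152 * 27` comes from the deviation bounds and the net; `4` from `1 - r = (1 - ‖A‖₂) / 2`,
  -- `82944 = 288 ^ 2` from the small-ball constant, `1024 = 2 ^ 10` from `s = 2 σ`
  refine ⟨49152 * 27 * 4 * 82944 * 1024, by norm_num, ?_⟩
  intro d Ω _ μ _ A x₀ w σ lam p δ hx₀ hw hA hσ hsub hlam hnd hp hp2 hatt hδ hδ1 T hT
  rcases Nat.eq_zero_or_pos d with rfl | hd
  · have huniv : {ω | lOneSolutions (traj A (x₀ ω) (fun t => w t ω)) T = {A}} = Set.univ := by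
      refine Set.eq_univ_of_forall fun ω => ?_
      refine Set.eq_singleton_iff_unique_mem.2 ⟨fun B' => ?_, fun B _ => Subsingleton.elim _ _⟩
      rw [Subsingleton.elim B' A]
    rw [huniv, measure_univ, ← ENNReal.ofReal_one]
    exact ENNReal.ofReal_le_ofReal (by linarith)
  set l := max 1 (Real.log (d * (σ / lam) / (δ * (1 - 2 * p) * (1 - opNormTwo A)))) with hl
  have hl1 : 1 ≤ l := le_max_left _ _
  have hd0 : (0 : ℝ) < d := by exact_mod_cast hd
  have hb0 : 0 < 1 - opNormTwo A := by linarith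
  have hq0 : 0 < 1 - 2 * p := by linarith
  have hX : d * (2 * σ / lam) / (δ * (1 - 2 * p) * (1 - opNormTwo A)) ≤ Real.exp (2 * l) := by
    have hX0 : 0 < d * (σ / lam) / (δ * (1 - 2 * p) * (1 - opNormTwo A)) := by positivity
    have h1 : d * (σ / lam) / (δ * (1 - 2 * p) * (1 - opNormTwo A)) ≤ Real.exp l :=
      (Real.log_le_iff_le_exp hX0).1 (le_max_right _ _)
    have h2 : 2 ≤ Real.exp l := by linarith [Real.add_one_le_exp l]
    calc d * (2 * σ / lam) / (δ * (1 - 2 * p) * (1 - opNormTwo A))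
        = 2 * (d * (σ / lam) / (δ * (1 - 2 * p) * (1 - opNormTwo A))) := by ring
      _ ≤ Real.exp l * Real.exp l := by gcongr
      _ = Real.exp (2 * l) := by rw [← Real.exp_add]; congr 1; ring
  have hT' : 49152 * (27 * d * l) ≤ T * p * (1 - 2 * p) ^ 2 * ((1 - opNormTwo A) / 2) ^ 2
      * ((lam / (2 * σ)) ^ 4 / 288) ^ 2 * (lam / (2 * σ)) ^ 2 := by
    have h1 : 49152 * 27 * 4 * 82944 * 1024 * (d * (σ / lam) ^ 10 /
        (p * (1 - 2 * p) ^ 2 * (1 - opNormTwo A) ^ 2) * l) ≤ T := by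
      refine le_trans ?_ hT
      gcongr
      exact le_max_right _ _
    calc 49152 * (27 * d * l)
        = 49152 * 27 * 4 * 82944 * 1024 * (d * (σ / lam) ^ 10 /
          (p * (1 - 2 * p) ^ 2 * (1 - opNormTwo A) ^ 2) * l) * p * (1 - 2 * p) ^ 2
          * ((1 - opNormTwo A) / 2) ^ 2 * ((lam / (2 * σ)) ^ 4 / 288) ^ 2
          * (lam / (2 * σ)) ^ 2 := by
          generalize 1 - 2 * p = q at hq0
          field_simp
          ring
      _ ≤ _ := by gcongr
  have hfail := measure_recovery_failure_le hd μ A hx₀ hw hA hp hp2 hatt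
    (s := 2 * σ) (by linarith) (isSubGaussianVec_of_vecPsiTwoNorm_le hσ hsub.1)
    (fun t => (hsub.2 t).mono fun ω hω => isSubGaussianVec_of_vecPsiTwoNorm_le hσ hω)
    hlam hnd hδ hδ1 hl1 hX hT'
  rw [ENNReal.ofReal_sub _ hδ.le, ENNReal.ofReal_one, tsub_le_iff_right]
  -- subadditivity suffices, so measurability of the recovery event is not needed
  calc (1 : ℝ≥0∞) = μ Set.univ := measure_univ.symm
    _ ≤ _ := by
      rw [← Set.union_compl_self {ω | lOneSolutions (traj A (x₀ ω) (fun t => w t ω)) T = {A}}]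
      exact (measure_union_le _ _).trans (add_le_add le_rfl hfail)
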